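/- Let $n\ge 4$, let $F_n$ be the free group on $x_1,\dots,x_n$, let $H=F_n^{\mathrm{ab}}\cong\mathbb Z^n$ and $H^*=\mathrm{Hom}_{\mathbb Z}(H,\mathbb Z)$, with dual basis $x_1^*,\dots,x_n^*$. Let $F_n^M=F_n/[[F_n,F_n],[F_n,F_n]]$ be the free metabelian group, with lower central series $\Gamma_n^M(1)=F_n^M$, $\Gamma_n^M(k+1)=[\Gamma_n^M(k),F_n^M]$, and let $$\mathcal L_n^M=\bigoplus_{k\ge1}\mathcal L_n^M(k),\qquad \mathcal L_n^M(k)=\Gamma_n^M(k)/\Gamma_n^M(k+1),$$ be the Chen Lie algebra, that is, the graded Lie algebra over $\mathbb Z$ whose bracket is induced by the group commutator; thus $\mathcal L_n^M(1)=H$. For $k\ge1$ let $\mathrm{Der}(\mathcal L_n^M)(k)$ be the group of derivations $D$ of $\mathcal L_n^M$ with $D(H)\subset\mathcal L_n^M(k+1)$; such a $D$ determines the element $\sum_i x_i^*\otimes D(x_i)$ of $H^*\otimes_{\mathbb Z}\mathcal L_n^M(k+1)$. Let $\mathrm{Der}^+(\mathcal L_n^M)=\sum_{k\ge1}\mathrm{Der}(\mathcal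 L_n^M)(k)$ be the Lie algebra of derivations of positive degree, and let $\mathfrak g^{\mathrm{ab}}=\mathfrak g/[\mathfrak g,\mathfrak g]$ for a Lie algebra $\mathfrak g$. Let $\mathcal L_n=\bigoplus_{k\ge 1}\mathcal L_n(k)$ be the free Lie algebra over $\mathbb Z$ generated by $H$, mapped to the tensor algebra of $H$ by the Lie algebra homomorphism that is the identity on $H$, so that $\mathcal L_n(k)$ is mapped to $H^{\otimes k}$. For $k\ge2$, Morita's trace map $\mathrm{Tr}_{[k]}:H^*\otimes_{\mathbb Z}\mathcal L_n(k+1)\to S^kH$ is the composition $$H^*\otimes_{\mathbb Z}\mathcal L_n(k+1)\to H^*\otimes_{\mathbb Z} H^{\otimes(k+1)}\to H^{\otimes k}\to S^kH,$$ where the second map is the contraction $f\otimes a_1\otimes\cdots\otimes a_{k+1}\mapsto f(a_1)\,a_2\otimes\cdots\otimes a_{k+1}$ and the third is the natural projection. Then, for every $k\ge 2$, $\mathrm{Tr}_{[k]}$ factors through the natural projection $H^*\otimes_{\mathbb Z}\mathcal L_n(k+1)\to H^*\otimes_{\mathbb Z}\mathcal L_n^M(k+1)$, and so induces a homomorphism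 $\mathrm{Tr}^M_{[k]}:H^*\otimes_{\mathbb Z}\mathcal L_n^M(k+1)\to S^kH$; and there is an isomorphism (of abelian Lie algebras) $$\mathrm{Der}^+(\mathcal L_n^M)^{\mathrm{ab}}\;\cong\;(H^*\otimes_{\mathbb Z}\Lambda^2H)\oplus\bigoplus_{k\ge2}S^kH$$ given by the degree one part and the trace maps: the class of $D\in\mathrm{Der}(\mathcal L_n^M)(1)$ is mapped to the element of the summand $H^*\otimes_{\mathbb Z}\Lambda^2H$ that corresponds to $\sum_i x_i^*\otimes D(x_i)\in H^*\otimes_{\mathbb Z}\mathcal L_n^M(2)$ under $\Lambda^2H\to\mathcal L_n^M(2)$, $a\wedge b\mapsto[a,b]$, and, for $k\ge2$, the class of $D\in\mathrm{Der}(\mathcal L_n^M)(k)$ is mapped to the element $\mathrm{Tr}^M_{[k]}\bigl(\sum_i x_i^*\otimes D(x_i)\bigr)$ of the summand $S^kH$. -/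

import Mathlib

open scoped TensorProduct DirectSum

noncomputable section

/-! ### The graded Lie ring of the lower central series of a group -/

namespace LCS

open scoped commutatorElement

variable (G : Type*) [Group G]

/-- `gam G k` is `Γ(k+1)`, where `Γ(1) = G` and `Γ(k+1) = [Γ(k), G]`. -/
abbrev gam (k : ℕ) : Subgroup G := (⊤ : Subgroup G).lowerCentralSeries k

/-- `Q G k = Γ(k+1) / Γ(k+2)`, written multiplicatively. -/
abbrev Q (k : ℕ) : Type _ := gam G k ⧸ (gam G (k + 1)).subgroupOf (gam G k)

variable {G}

theorem gam_anti {i j : ℕ} (h : i ≤ j) : gam G j ≤ gam G i :=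
  Subgroup.lowerCentralSeries_antitone _ h

theorem comm_mem {j : ℕ} : ∀ {i : ℕ} {x y : G}, x ∈ gam G i → y ∈ gam G j →
    ⁅x, y⁆ ∈ gam G (i + j + 1) := by
  induction j with
  | zero =>
    intro i x y hx hy
    exact Subgroup.commutator_mem_commutator hx hy
  | succ j ih =>
    intro i x y hx hy
    have key : ⁅gam G i, ⁅gam G j, (⊤ : Subgroup G)⁆⁆ ≤ gam G (i + (j + 1) + 1) := by
      rw [Subgroup.commutator_comm, Subgroup.commutator_le]
      intro g hg x hx
      rw [← commutatorElement_inv]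
      apply inv_mem
      revert x
      rw [Subgroup.commutator_def] at hg
      induction hg using Subgroup.closure_induction with
      | mem g hg =>
        obtain ⟨y, hy, z, -, rfl⟩ := hg
        intro x hx
        have h1 : ⁅y⁻¹, ⁅z⁻¹, x⁆⁆ ∈ gam G (i + (j + 1) + 1) := by
          have hzx : ⁅z⁻¹, x⁆ ∈ gam G (i + 1) := by
            rw [← commutatorElement_inv]
            exact inv_mem (Subgroup.commutator_mem_commutator hx (Subgroup.mem_top _))
          rw [← commutatorElement_inv]
          have := inv_mem (ih hzx (inv_mem hy))
          rwa [show i + 1 + j + 1 = i + (j + 1) + 1 by ring] at this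
        have h2 : ⁅z, ⁅x⁻¹, y⁻¹⁆⁆ ∈ gam G (i + (j + 1) + 1) := by
          rw [← commutatorElement_inv]
          exact inv_mem (Subgroup.commutator_mem_commutator (ih (inv_mem hx) (inv_mem hy))
            (Subgroup.mem_top _))
        have hw := conj_commutatorElement_right_commutatorElement_mul x y⁻¹ z
        rw [inv_inv] at hw
        have e : ⁅x, ⁅y, z⁆⁆ = y * ((z * ⁅y⁻¹, ⁅z⁻¹, x⁆⁆ * z⁻¹) *
            (x * ⁅z, ⁅x⁻¹, y⁻¹⁆⁆ * x⁻¹))⁻¹ * y⁻¹ := by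
          have h3 : (y⁻¹ * ⁅x, ⁅y, z⁆⁆ * y) * ((z * ⁅y⁻¹, ⁅z⁻¹, x⁆⁆ * z⁻¹) *
            (x * ⁅z, ⁅x⁻¹, y⁻¹⁆⁆ * x⁻¹)) = 1 := by simpa only [mul_assoc] using hw
          rw [← eq_inv_of_mul_eq_one_left h3]
          group
        rw [e]
        have N : (gam G (i + (j + 1) + 1)).Normal := inferInstance
        exact N.conj_mem _ (inv_mem (mul_mem (N.conj_mem _ h1 _) (N.conj_mem _ h2 _))) _
      | one => intro x hx; simp
      | mul a b _ _ ha hb =>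
        intro x hx
        rw [commutatorElement_mul_right_eq_mul_conj, mul_assoc, mul_assoc, ← mul_assoc a]
        have N : (gam G (i + (j + 1) + 1)).Normal := inferInstance
        exact mul_mem (ha x hx) (N.conj_mem _ (hb x hx) _)
      | inv a _ ha =>
        intro x hx
        rw [commutatorElement_inv_right, ← commutatorElement_inv]
        have N : (gam G (i + (j + 1) + 1)).Normal := inferInstance
        simpa using N.conj_mem _ (inv_mem (ha x hx)) a⁻¹
    exact key (Subgroup.commutator_mem_commutator hx hy)

instance (k : ℕ) : CommGroup (Q G k) :=
  { (inferInstance : Group (Q G k)) with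
    mul_comm := by
      intro a b
      induction a using QuotientGroup.induction_on with | H a =>
      induction b using QuotientGroup.induction_on with | H b =>
      rw [← QuotientGroup.mk_mul, ← QuotientGroup.mk_mul, QuotientGroup.eq,
        Subgroup.mem_subgroupOf]
      have h := comm_mem (inv_mem b.2) (inv_mem a.2)
      have h' := gam_anti (show k + 1 ≤ k + k + 1 by omega) h
      simpa [commutatorElement_def, mul_assoc] using h' }

/-- The class in `Γ(k+1) / Γ(k+2)` of an element of `Γ(k+1)`. -/
def qmk (k : ℕ) (g : G) (hg : g ∈ gam G k) : Q G k := QuotientGroup.mk ⟨g, hg⟩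

theorem qmk_eq {k : ℕ} {g h : G} {hg : g ∈ gam G k} {hh : h ∈ gam G k}
    (e : g⁻¹ * h ∈ gam G (k + 1)) : qmk k g hg = qmk k h hh := by
  rw [qmk, qmk, QuotientGroup.eq, Subgroup.mem_subgroupOf]
  exact e

theorem qmk_mul {k : ℕ} {g h : G} (hg : g ∈ gam G k) (hh : h ∈ gam G k) :
    qmk k (g * h) (mul_mem hg hh) = qmk k g hg * qmk k h hh := rfl

theorem conj_mem {k : ℕ} {g : G} (hg : g ∈ gam G k) (a : G) : a * g * a⁻¹ ∈ gam G k :=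
  (inferInstance : (gam G k).Normal).conj_mem g hg a

theorem qmk_conj {k : ℕ} {g : G} (hg : g ∈ gam G k) (a : G) :
    qmk k (a * g * a⁻¹) (conj_mem hg a) = qmk k g hg := by
  apply qmk_eq
  have h : ⁅g⁻¹, a⁆⁻¹ ∈ gam G (k + 1) :=
    inv_mem (Subgroup.commutator_mem_commutator (inv_mem hg) (Subgroup.mem_top a))
  simpa [commutatorElement_def, mul_assoc] using h

theorem qmk_comm_mul_right {i j : ℕ} {x y z : G} (hx : x ∈ gam G i) (hy : y ∈ gam G j)
    (hz : z ∈ gam G j) :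
    qmk (i + j + 1) ⁅x, y * z⁆ (comm_mem hx (mul_mem hy hz)) =
      qmk (i + j + 1) ⁅x, y⁆ (comm_mem hx hy) * qmk (i + j + 1) ⁅x, z⁆ (comm_mem hx hz) := by
  rw [← qmk_conj (comm_mem hx hz) y, ← qmk_mul]
  congr 1
  rw [commutatorElement_mul_right_eq_mul_conj]
  simp only [mul_assoc]

theorem qmk_comm_mul_left {i j : ℕ} {x y z : G} (hx : x ∈ gam G i) (hy : y ∈ gam G i)
    (hz : z ∈ gam G j) :
    qmk (i + j + 1) ⁅x * y, z⁆ (comm_mem (mul_mem hx hy) hz) =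
      qmk (i + j + 1) ⁅x, z⁆ (comm_mem hx hz) * qmk (i + j + 1) ⁅y, z⁆ (comm_mem hy hz) := by
  rw [mul_comm, ← qmk_conj (comm_mem hy hz) x, ← qmk_mul]
  congr 1
  rw [commutatorElement_mul_left_eq_conj_mul]

theorem qmk_eq_one {k : ℕ} {g : G} {hg : g ∈ gam G k} (h : g ∈ gam G (k + 1)) :
    qmk k g hg = 1 := by
  rw [qmk, QuotientGroup.eq_one_iff, Subgroup.mem_subgroupOf]
  exact h

/-- The pairing `Γ(i+1)/Γ(i+2) × Γ(j+1)/Γ(j+2) → Γ(i+j+2)/Γ(i+j+3)` induced by the commutator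
`(x, y) ↦ [x, y] = x y x⁻¹ y⁻¹`. -/
def brQ (i j : ℕ) : Q G i →* Q G j →* Q G (i + j + 1) :=
  QuotientGroup.lift _
    { toFun := fun x => QuotientGroup.lift _
        { toFun := fun y => qmk (i + j + 1) ⁅(x : G), (y : G)⁆ (comm_mem x.2 y.2)
          map_one' := qmk_eq_one (by simp)
          map_mul' := fun y z => qmk_comm_mul_right x.2 y.2 z.2 }
        (fun y hy => qmk_eq_one (comm_mem (j := j + 1) x.2 (Subgroup.mem_subgroupOf.1 hy)))
      map_one' := by
        refine MonoidHom.ext fun y => ?_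
        induction y using QuotientGroup.induction_on with | H y =>
        exact qmk_eq_one (by simp)
      map_mul' := fun x x' => by
        refine MonoidHom.ext fun y => ?_
        induction y using QuotientGroup.induction_on with | H y =>
        exact qmk_comm_mul_left x.2 x'.2 y.2 }
    (fun x hx => by
      refine MonoidHom.ext fun y => ?_
      induction y using QuotientGroup.induction_on with | H y =>
      refine qmk_eq_one ?_
      have := comm_mem (i := i + 1) (Subgroup.mem_subgroupOf.1 hx) y.2
      rwa [show i + 1 + j + 1 = i + j + 1 + 1 by ring] at this)

theorem brQ_qmk {i j : ℕ} {x y : G} (hx : x ∈ gam G i) (hy : y ∈ gam G j) :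
    brQ i j (qmk i x hx) (qmk j y hy) = qmk (i + j + 1) ⁅x, y⁆ (comm_mem hx hy) := rfl

variable (G)

/-- The homogeneous part of degree `k + 1`: the group `Γ(k+1) / Γ(k+2)`, written additively. -/
abbrev Piece (k : ℕ) : Type _ := Additive (Q G k)

/-- The graded sum `⨁_{k ≥ 1} Γ(k) / Γ(k+1)`. The summand with index `k` has degree `k + 1`. -/
def Gr : Type _ := ⨁ k : ℕ, Piece G k

instance : AddCommGroup (Gr G) := inferInstanceAs (AddCommGroup (⨁ k : ℕ, Piece G k))

/-- The inclusion of the homogeneous part of degree `k + 1`. -/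
def incl (k : ℕ) : Piece G k →+ Gr G := DirectSum.of (Piece G) k

variable {G}

/-- The commutator pairing of homogeneous parts, in additive notation. -/
def br (i j : ℕ) : Piece G i →+ Piece G j →+ Piece G (i + j + 1) :=
  AddMonoidHom.mk' (fun a => MonoidHom.toAdditive (brQ i j a.toMul)) (fun a b => by
    rw [toMul_add, map_mul]
    rfl)

/-- The biadditive extension of the commutator pairings to the graded sum. -/
def brSum : (⨁ k : ℕ, Piece G k) →+ (⨁ k : ℕ, Piece G k) →+ (⨁ k : ℕ, Piece G k) :=
  DirectSum.toAddMonoid fun i => AddMonoidHom.flip <|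
    DirectSum.toAddMonoid fun j => AddMonoidHom.flip <|
      (DirectSum.of (Piece G) (i + j + 1)).compHom.comp (br i j)

theorem brSum_of (i j : ℕ) (a : Piece G i) (b : Piece G j) :
    brSum (DirectSum.of (Piece G) i a) (DirectSum.of (Piece G) j b) =
      DirectSum.of (Piece G) (i + j + 1) (br i j a b) := by
  simp only [brSum, DirectSum.toAddMonoid_of, AddMonoidHom.flip_apply, AddMonoidHom.coe_comp,
    Function.comp_apply, AddMonoidHom.compHom_apply_apply]

/-- The bracket of the graded sum. -/
def brHom : Gr G →+ Gr G →+ Gr G := brSum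

theorem brHom_incl (i j : ℕ) (a : Piece G i) (b : Piece G j) :
    brHom (incl G i a) (incl G j b) = incl G (i + j + 1) (br i j a b) := brSum_of i j a b

/-- The class in degree `k + 1` of an element of `Γ(k+1)`. -/
def cls (k : ℕ) (g : G) (hg : g ∈ gam G k) : Gr G := incl G k (Additive.ofMul (qmk k g hg))

theorem cls_eq {k : ℕ} {g h : G} {hg : g ∈ gam G k} {hh : h ∈ gam G k}
    (e : qmk k g hg = qmk k h hh) : cls k g hg = cls k h hh := by
  rw [cls, cls, e]

theorem cls_mul {k : ℕ} {g h : G} (hg : g ∈ gam G k) (hh : h ∈ gam G k) :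
    cls k (g * h) (mul_mem hg hh) = cls k g hg + cls k h hh := by
  rw [cls, qmk_mul, ofMul_mul, map_add]
  rfl

theorem cls_eq_zero {k : ℕ} {g : G} {hg : g ∈ gam G k} (h : g = 1) : cls k g hg = 0 := by
  rw [cls, qmk_eq_one (h ▸ one_mem _), ofMul_one, map_zero]

theorem cls_congr {k l : ℕ} {g : G} {hg : g ∈ gam G k} (e : k = l) :
    cls k g hg = cls l g (e ▸ hg) := by
  subst e
  rfl

theorem brHom_cls {i j : ℕ} {x y : G} (hx : x ∈ gam G i) (hy : y ∈ gam G j) :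
    brHom (cls i x hx) (cls j y hy) = cls (i + j + 1) ⁅x, y⁆ (comm_mem hx hy) := by
  rw [cls, cls, brHom_incl]
  rfl

theorem gr_induction {p : Gr G → Prop} (x : Gr G) (zero : p 0)
    (hom : ∀ k g hg, p (cls k g hg)) (add : ∀ a b, p a → p b → p (a + b)) : p x := by
  refine DirectSum.induction_on (motive := p) x zero (fun k a => ?_) add
  obtain ⟨⟨g, hg⟩, rfl⟩ := QuotientGroup.mk_surjective a.toMul
  exact hom k g hg

theorem brHom_skew (x y : Gr G) : brHom x y + brHom y x = 0 := by
  induction x using gr_induction with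
  | zero => simp
  | add a b ha hb =>
    rw [map_add, map_add, AddMonoidHom.add_apply, add_add_add_comm, ha, hb, add_zero]
  | hom i g hg =>
    induction y using gr_induction with
    | zero => simp
    | add a b ha hb =>
      rw [map_add, map_add, AddMonoidHom.add_apply, add_add_add_comm, ha, hb, add_zero]
    | hom j h hh =>
      rw [brHom_cls, brHom_cls, cls_congr (show j + i + 1 = i + j + 1 by ring), ← cls_mul]
      exact cls_eq_zero (by rw [← commutatorElement_inv, inv_mul_cancel])

theorem brHom_self (x : Gr G) : brHom x x = 0 := by
  induction x using gr_induction with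
  | zero => simp
  | add a b ha hb =>
    rw [map_add, map_add, AddMonoidHom.add_apply, AddMonoidHom.add_apply, ha, hb, zero_add,
      add_zero, brHom_skew]
  | hom i g hg =>
    rw [brHom_cls]
    exact cls_eq_zero (commutatorElement_self g)

theorem brHom_cyc (x y z : Gr G) :
    brHom x (brHom y z) + brHom y (brHom z x) + brHom z (brHom x y) = 0 := by
  induction x using gr_induction with
  | zero => simp
  | add a b ha hb =>
    simp only [map_add, AddMonoidHom.add_apply]
    calc _ = (brHom a (brHom y z) + brHom y (brHom z a) + brHom z (brHom a y)) +
          (brHom b (brHom y z) + brHom y (brHom z b) + brHom z (brHom b y)) := by abel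
      _ = 0 := by rw [ha, hb, add_zero]
  | hom i a ha =>
    induction y using gr_induction with
    | zero => simp
    | add u v hu hv =>
      simp only [map_add, AddMonoidHom.add_apply]
      calc _ = (brHom (cls i a ha) (brHom u z) + brHom u (brHom z (cls i a ha)) +
              brHom z (brHom (cls i a ha) u)) +
            (brHom (cls i a ha) (brHom v z) + brHom v (brHom z (cls i a ha)) +
              brHom z (brHom (cls i a ha) v)) := by abel
        _ = 0 := by rw [hu, hv, add_zero]
    | hom j b hb =>
      induction z using gr_induction with
      | zero => simp
      | add u v hu hv =>
        simp only [map_add, AddMonoidHom.add_apply]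
        calc _ = (brHom (cls i a ha) (brHom (cls j b hb) u) +
                brHom (cls j b hb) (brHom u (cls i a ha)) +
                brHom u (brHom (cls i a ha) (cls j b hb))) +
              (brHom (cls i a ha) (brHom (cls j b hb) v) +
                brHom (cls j b hb) (brHom v (cls i a ha)) +
                brHom v (brHom (cls i a ha) (cls j b hb))) := by abel
          _ = 0 := by rw [hu, hv, add_zero]
      | hom k c hc =>
        rw [← cls_eq (qmk_conj ha c), ← cls_eq (qmk_conj hb a), ← cls_eq (qmk_conj hc b)]
        have e1 : brHom (cls j b hb) (cls k c hc) = cls (j + k + 1) ⁅b, c⁆ (comm_mem hb hc) :=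
          brHom_cls hb hc
        have e2 : brHom (cls k c hc) (cls i a ha) = cls (k + i + 1) ⁅c, a⁆ (comm_mem hc ha) :=
          brHom_cls hc ha
        have e3 : brHom (cls i a ha) (cls j b hb) = cls (i + j + 1) ⁅a, b⁆ (comm_mem ha hb) :=
          brHom_cls ha hb
        have h1 := brHom_cls (conj_mem ha c) (comm_mem hb hc)
        have h2 := brHom_cls (conj_mem hb a) (comm_mem hc ha)
        have h3 := brHom_cls (conj_mem hc b) (comm_mem ha hb)
        rw [cls_eq (qmk_conj ha c)] at h1 ⊢
        rw [cls_eq (qmk_conj hb a)] at h2 ⊢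
        rw [cls_eq (qmk_conj hc b)] at h3 ⊢
        rw [e1, e2, e3, h1, h2, h3,
          cls_congr (show j + (k + i + 1) + 1 = i + (j + k + 1) + 1 by ring),
          cls_congr (show k + (i + j + 1) + 1 = i + (j + k + 1) + 1 by ring),
          add_comm (cls _ ⁅c * a * c⁻¹, ⁅b, c⁆⁆ _), ← cls_mul, ← cls_mul]
        exact cls_eq_zero (commutatorElement_conj_commutatorElement_mul a b c)

/-- The graded Lie ring structure induced by the commutator bracket of the group. -/
instance : LieRing (Gr G) where
  bracket x y := brHom x y
  add_lie x y z := by change brHom (x + y) z = _; rw [map_add]; rfl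
  lie_add x y z := map_add (brHom x) y z
  lie_self x := brHom_self x
  leibniz_lie x y z := by
    change brHom x (brHom y z) = brHom (brHom x y) z + brHom y (brHom x z)
    have h := brHom_cyc x y z
    have h1 := brHom_skew z (brHom x y)
    have h2 : brHom y (brHom z x) = -brHom y (brHom x z) := by
      rw [← map_neg, eq_neg_of_add_eq_zero_left (brHom_skew z x)]
    rw [h2, eq_neg_of_add_eq_zero_left h1] at h
    rw [← sub_eq_zero, ← h]
    abel

theorem lie_cls {i j : ℕ} {x y : G} (hx : x ∈ gam G i) (hy : y ∈ gam G j) :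
    ⁅cls i x hx, cls j y hy⁆ = cls (i + j + 1) ⁅x, y⁆ (comm_mem hx hy) := brHom_cls hx hy

variable (G)

/-- The homogeneous part of degree `k + 1`, as a submodule of the graded sum. -/
def part (k : ℕ) : Submodule ℤ (Gr G) := LinearMap.range (incl G k).toIntLinearMap

/-- The derivations of degree `k`: those that map the degree one part into degree `k + 1`. -/
def derDeg (k : ℕ) : Submodule ℤ (LieDerivation ℤ (Gr G) (Gr G)) where
  carrier := {D | ∀ x ∈ part G 0, D x ∈ part G k}
  add_mem' h1 h2 x hx := add_mem (h1 x hx) (h2 x hx)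
  zero_mem' _ _ := zero_mem _
  smul_mem' c _ h x hx := Submodule.smul_mem _ c (h x hx)

variable {G}

theorem cls_mem (k : ℕ) (g : G) (hg : g ∈ gam G k) : cls k g hg ∈ part G k := ⟨_, rfl⟩

theorem mem_part {k : ℕ} {x : Gr G} (hx : x ∈ part G k) : ∃ g hg, x = cls k g hg := by
  obtain ⟨a, rfl⟩ := hx
  obtain ⟨⟨g, hg⟩, ha⟩ := QuotientGroup.mk_surjective a.toMul
  exact ⟨g, hg, congrArg (incl G k) (congrArg Additive.ofMul ha.symm)⟩

theorem lie_mem_part {i j : ℕ} {x y : Gr G} (hx : x ∈ part G i) (hy : y ∈ part G j) :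
    ⁅x, y⁆ ∈ part G (i + j + 1) := by
  obtain ⟨g, hg, rfl⟩ := mem_part hx
  obtain ⟨h, hh, rfl⟩ := mem_part hy
  rw [lie_cls]
  exact cls_mem _ _ _

theorem derDeg_apply_mem {k : ℕ} {D : LieDerivation ℤ (Gr G) (Gr G)} (hD : D ∈ derDeg G k)
    (m : ℕ) : ∀ x ∈ part G m, D x ∈ part G (m + k) := by
  induction m with
  | zero => intro x hx; rw [zero_add]; exact hD x hx
  | succ m ih =>
    intro x hx
    obtain ⟨g, hg, rfl⟩ := mem_part hx
    clear hx
    suffices h : ∀ hg' : g ∈ gam G (m + 1), D (cls (m + 1) g hg') ∈ part G (m + 1 + k) from h hg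
    have hg0 := (Subgroup.mem_lowerCentralSeries_succ_iff (S := ⊤) m g).1 hg
    clear hg
    induction hg0 using Subgroup.closure_induction with
    | mem g hg =>
      obtain ⟨p, hp, q, -, rfl⟩ := hg
      intro h
      have hq : q ∈ gam G 0 := Subgroup.mem_top q
      have e : cls (m + 1) ⁅p, q⁆ h = ⁅cls m p hp, cls 0 q hq⁆ := (lie_cls hp hq).symm
      rw [e, LieDerivation.apply_lie_eq_add]
      refine add_mem ?_ ?_
      · have := lie_mem_part (cls_mem m p hp) (hD _ (cls_mem 0 q hq))
        rwa [show m + k + 1 = m + 1 + k by ring] at this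
      · have := lie_mem_part (ih _ (cls_mem m p hp)) (cls_mem 0 q hq)
        rwa [show m + k + 0 + 1 = m + 1 + k by ring] at this
    | one => intro h; rw [cls_eq_zero rfl, map_zero]; exact zero_mem _
    | mul a b ha' hb' ha hb =>
      intro h
      have ha'' : a ∈ gam G (m + 1) := ha'
      have hb'' : b ∈ gam G (m + 1) := hb'
      rw [show cls (m + 1) (a * b) h = _ from cls_mul ha'' hb'', map_add]
      exact add_mem (ha ha'') (hb hb'')
    | inv a ha' ha =>
      intro h
      have ha'' : a ∈ gam G (m + 1) := ha'
      have e : cls (m + 1) a⁻¹ h = - cls (m + 1) a ha'' := by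
        rw [eq_neg_iff_add_eq_zero, ← cls_mul h ha'']
        exact cls_eq_zero (inv_mul_cancel a)
      rw [e, map_neg]
      exact neg_mem (ha ha'')

theorem derDeg_lie_mem {j k : ℕ} {D E : LieDerivation ℤ (Gr G) (Gr G)} (hD : D ∈ derDeg G j)
    (hE : E ∈ derDeg G k) : ⁅D, E⁆ ∈ derDeg G (j + k) := by
  intro x hx
  rw [LieDerivation.lie_apply]
  refine sub_mem ?_ ?_
  · have := derDeg_apply_mem hD k _ (hE x hx)
    rwa [add_comm] at this
  · exact derDeg_apply_mem hE j _ (hD x hx)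

theorem iSup_lie_mem {D E : LieDerivation ℤ (Gr G) (Gr G)}
    (hD : D ∈ ⨆ k : ℕ, derDeg G (k + 1)) (hE : E ∈ ⨆ k : ℕ, derDeg G (k + 1)) :
    ⁅D, E⁆ ∈ ⨆ k : ℕ, derDeg G (k + 1) := by
  induction hD using Submodule.iSup_induction' with
  | zero => rw [zero_lie]; exact zero_mem _
  | add a b _ _ ha hb => rw [add_lie]; exact add_mem ha hb
  | mem j D hD =>
    induction hE using Submodule.iSup_induction' with
    | zero => rw [lie_zero]; exact zero_mem _
    | add a b _ _ ha hb => rw [lie_add]; exact add_mem ha hb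
    | mem k E hE =>
      have h : ⁅D, E⁆ ∈ derDeg G (j + 1 + (k + 1)) := derDeg_lie_mem hD hE
      rw [← add_assoc] at h
      exact (le_iSup (fun k : ℕ => derDeg G (k + 1)) (j + 1 + k)) h

variable (G)

/-- The Lie algebra of derivations of positive degree: the sum, over `k ≥ 1`, of the derivations of
degree `k`. -/
def derPlus : LieSubalgebra ℤ (LieDerivation ℤ (Gr G) (Gr G)) where
  toSubmodule := ⨆ k : ℕ, derDeg G (k + 1)
  lie_mem' := fun hD hE => iSup_lie_mem hD hE

end LCS

/-- The abelianization `L / [L, L]` of a Lie algebra. -/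
abbrev LieAb (L : Type*) [LieRing L] [LieAlgebra ℤ L] : Type _ :=
  L ⧸ (⁅(⊤ : LieIdeal ℤ L), (⊤ : LieIdeal ℤ L)⁆ : LieIdeal ℤ L)

namespace Chen

variable (n : ℕ)

/-- The free metabelian group `F_n / [[F_n, F_n], [F_n, F_n]]`. -/
abbrev FM : Type :=
  FreeGroup (Fin n) ⧸ ⁅commutator (FreeGroup (Fin n)), commutator (FreeGroup (Fin n))⁆

/-- The Chen Lie algebra: the graded Lie ring of the lower central series of `FM n`. -/
abbrev LM : Type := LCS.Gr (FM n)

/-- `H`, the abelianization of `F_n` (this is how Mathlib defines `FreeAbelianGroup`). -/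
abbrev H : Type := FreeAbelianGroup (Fin n)

/-- The class in `LM n`, in degree one, of the `i`-th generator. -/
def gen (i : Fin n) : LM n :=
  LCS.cls 0 (QuotientGroup.mk (FreeGroup.of i)) (Subgroup.mem_top _)

/-- The canonical map of `H` onto the degree one part of `LM n`. -/
def inclH : H n →ₗ[ℤ] LM n := (FreeAbelianGroup.lift (gen n)).toIntLinearMap

/-- The element `∑ x_i^* ⊗ D(x_i)` of `H^* ⊗ LM n` that corresponds to the restriction of the
derivation `D` to `H`. -/
def restr (D : LieDerivation ℤ (LM n) (LM n)) : Module.Dual ℤ (H n) ⊗[ℤ] LM n :=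
  ∑ i, (FreeAbelianGroup.basis (Fin n)).coord i ⊗ₜ[ℤ] D (gen n i)

/-- The map `Λ²H → LM n`, `a ∧ b ↦ [a, b]`. -/
def wedgeToLM : ⋀[ℤ]^2 (H n) →ₗ[ℤ] LM n :=
  exteriorPower.alternatingMapLinearEquiv
    { toFun := fun v => ⁅inclH n (v 0), inclH n (v 1)⁆
      map_update_add' := by
        intro _ v i x y
        fin_cases i <;> simp [Function.update]
      map_update_smul' := by
        intro _ v i c x
        fin_cases i <;> simp [Function.update]
      map_eq_zero_of_eq' := by
        intro v i j h hij
        fin_cases i <;> fin_cases j <;> simp_all }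

/-- The free Lie algebra generated by `H`. -/
abbrev L : Type := FreeLieAlgebra ℤ (Fin n)

attribute [local instance] LieRing.ofAssociativeRing LieAlgebra.ofAssociativeAlgebra

/-- The Lie algebra homomorphism of `L n` to the tensor algebra of `H` that is the identity
on `H`. -/
def iota : L n →ₗ⁅ℤ⁆ TensorAlgebra ℤ (H n) :=
  FreeLieAlgebra.lift ℤ fun i => TensorAlgebra.ι ℤ (FreeAbelianGroup.of i)

/-- The component of degree `k` of `iota`, with values in `H^{⊗ k}`. -/
def iotaDeg (k : ℕ) : L n →ₗ[ℤ] ⨂[ℤ]^k (H n) :=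
  DirectSum.component ℤ ℕ (fun k => ⨂[ℤ]^k (H n)) k ∘ₗ
    TensorAlgebra.equivDirectSum.toLinearMap ∘ₗ (iota n : L n →ₗ[ℤ] TensorAlgebra ℤ (H n))

/-- The natural projection of `L n` onto `LM n`. -/
def proj : L n →ₗ⁅ℤ⁆ LM n := FreeLieAlgebra.lift ℤ (gen n)

/-- The contraction `f ⊗ a_1 ⊗ ⋯ ⊗ a_{k+1} ↦ f(a_1) a_2 ⊗ ⋯ ⊗ a_{k+1}`. -/
def contr (k : ℕ) : Module.Dual ℤ (H n) →ₗ[ℤ] ⨂[ℤ]^(k + 1) (H n) →ₗ[ℤ] ⨂[ℤ]^k (H n) where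
  toFun f := PiTensorProduct.lift
    (LinearMap.uncurryLeft (f.smulRight (PiTensorProduct.tprod ℤ (s := fun _ : Fin k => H n))))
  map_add' f g := by
    ext v
    simp [add_smul]
  map_smul' c f := by
    ext v
    simp [mul_smul]

/-- Morita's trace map: the contraction `H^* ⊗ L_n(k+1) → H^{⊗ k}` followed by the projection to
`S^k H`. It is extended by zero to the parts `H^* ⊗ L_n(l)` with `l ≠ k + 1`. -/
def trace (k : ℕ) : Module.Dual ℤ (H n) ⊗[ℤ] L n →ₗ[ℤ] Sym[ℤ]^k (H n) :=
  SymmetricPower.mk ℤ (Fin k) (H n) ∘ₗ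
    TensorProduct.lift ((contr n k).compl₂ (iotaDeg n (k + 1)))

end Chen

end

/-! The proof is linear algebra over the polynomial ring R = ℤ[X_1,…,X_n], reached through the
Magnus embedding. Fox derivatives specialised at x_i ↦ 1 + tX_i define a homomorphism of the free
metabelian group. Its leading coefficients in t give a map `foxMap` of the Chen Lie algebra to R^n
which sends x_i to the i-th unit vector and satisfies [x,y] ↦ ε(y)x − ε(x)y, where ε(w) = ∑ X_i w_i
(`foxMap_lie`). This map is injective (`foxMap_injective`). The part N of degree at least two is
abelian, so the operators [·, x_j] commute on it and make it an R-module generated by the [x_i,x_j].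
The Jacobi identity gives these generators the Koszul relations, which is what a left inverse of
`foxMap` on N needs.

A derivation of positive degree has values in N, where ε vanishes. It therefore acts on the image in
R^n as an R-linear matrix (`foxMap_derPlus_apply`), and the bracket of derivations becomes the
commutator of matrices (`mat_lie`). So the matrix trace vanishes on brackets. The degree one part
vanishes on them too, since brackets have degree at least two.

Conversely, the derivations are spanned by the elementary ones, x_r ↦ f[x_p,x_q] with f a monomial.
Their matrices have rank one, and their brackets are explicit (`elemDer_lie`). In degree at least
two, an elementary derivation with r outside {p,q} is a bracket, and modulo brackets the others
depend only on their trace, which up to sign is a monomial (`map_elemDer_congr`). Thus any additive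
function that vanishes on brackets factors through the trace in these degrees
(`map_eq_sigma_trace`). Applied to the quotient map, this identifies the kernel (`ker_total`).
Surjectivity is direct: fX_j is the trace of x_i ↦ f[x_i,x_j] for i ≠ j.

Morita's trace is the matrix trace. On the tensor algebra the map h_1⊗⋯⊗h_k ↦ (h_2⋯h_k)h_1 obeys the
product rule of Fox derivatives, so on the free Lie algebra it coincides with `foxMap` after
projection (`headTail_iota`). Contraction with f followed by symmetrisation is then w ↦ ∑ f(x_i)w_i,
which sees only the image in the Chen Lie algebra and gives the trace on ∑ x_i^*⊗D(x_i). -/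

open scoped TensorProduct DirectSum

noncomputable section

namespace Chen

/-! ### The group of Fox derivatives -/

/-- Vectors of polynomials: the target of the leading terms of the Fox derivatives. -/
abbrev W (n : ℕ) : Type := Fin n → MvPolynomial (Fin n) ℤ

/-- The linear map `w ↦ ∑ X_i w_i`. -/
def euler (n : ℕ) : W n →ₗ[MvPolynomial (Fin n) ℤ] MvPolynomial (Fin n) ℤ :=
  Fintype.linearCombination _ MvPolynomial.X

theorem euler_apply {n : ℕ} (w : W n) : euler n w = ∑ i, MvPolynomial.X i * w i := by
  simp [euler, Fintype.linearCombination_apply, mul_comm]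

theorem euler_single {n : ℕ} (i : Fin n) (p : MvPolynomial (Fin n) ℤ) :
    euler n (Pi.single i p) = MvPolynomial.X i * p := by
  rw [euler_apply, Finset.sum_eq_single i]
  · simp
  · intro j _ hj; simp [hj]
  · simp

/-- Vectors of power series in `t` over the polynomial ring, with the group law
`v * w = v + w + e(w) v`, where `e(w) = t ∑ X_i w_i`: the law satisfied by the vectors of Fox
derivatives. -/
@[ext] structure Fox (n : ℕ) where
  /-- The underlying vector. -/
  val : Fin n → PowerSeries (MvPolynomial (Fin n) ℤ)

namespace Fox

variable {n : ℕ}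

/-- The functional `v ↦ t ∑ X_i v_i`. -/
def e (n : ℕ) : (Fin n → PowerSeries (MvPolynomial (Fin n) ℤ)) →ₗ[PowerSeries (MvPolynomial (Fin n) ℤ)]
    PowerSeries (MvPolynomial (Fin n) ℤ) :=
  Fintype.linearCombination _ fun i => PowerSeries.X * PowerSeries.C (MvPolynomial.X i)

theorem e_apply (v : Fin n → PowerSeries (MvPolynomial (Fin n) ℤ)) :
    e n v = PowerSeries.X * ∑ i, PowerSeries.C (MvPolynomial.X i) * v i := by
  simp only [e, Fintype.linearCombination_apply, Finset.mul_sum, smul_eq_mul]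
  exact Finset.sum_congr rfl fun i _ => by ring

/-- The inverse of `1 + e(v)`. -/
def unitInv (v : Fin n → PowerSeries (MvPolynomial (Fin n) ℤ)) :
    PowerSeries (MvPolynomial (Fin n) ℤ) :=
  PowerSeries.invOfUnit (1 + e n v) 1

theorem constantCoeff_e (v : Fin n → PowerSeries (MvPolynomial (Fin n) ℤ)) :
    PowerSeries.constantCoeff (e n v) = 0 := by
  rw [e_apply]; simp

theorem mul_unitInv (v : Fin n → PowerSeries (MvPolynomial (Fin n) ℤ)) :
    (1 + e n v) * unitInv v = 1 :=
  PowerSeries.mul_invOfUnit _ _ (by simp [constantCoeff_e])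

instance : Mul (Fox n) := ⟨fun v w => ⟨v.val + w.val + e n w.val • v.val⟩⟩
instance : One (Fox n) := ⟨⟨0⟩⟩
instance : Inv (Fox n) := ⟨fun v => ⟨-(unitInv v.val • v.val)⟩⟩

theorem val_mul (v w : Fox n) : (v * w).val = v.val + w.val + e n w.val • v.val := rfl
theorem val_one : (1 : Fox n).val = 0 := rfl
theorem val_inv (v : Fox n) : (v⁻¹).val = -(unitInv v.val • v.val) := rfl

instance : Group (Fox n) :=
  Group.ofLeftAxioms
    (by
      intro a b c
      ext1
      funext i
      simp only [val_mul, map_add, map_smul, Pi.add_apply, Pi.smul_apply, smul_eq_mul]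
      ring)
    (by
      intro a
      ext1
      simp [val_mul, val_one])
    (by
      intro a
      ext1
      have h := mul_unitInv a.val
      funext i
      simp only [val_mul, val_one, val_inv, Pi.add_apply, Pi.smul_apply, Pi.neg_apply,
        Pi.zero_apply, smul_eq_mul]
      linear_combination (-a.val i) * h)

/-- The series 1 + e(v) is the value of the group element under x_i ↦ 1 + tX_i. The group law is the
Fox rule d(gh) = d(g)·h + d(h) under this specialisation. -/
theorem one_add_e_mul (v w : Fox n) :
    1 + e n (v * w).val = (1 + e n v.val) * (1 + e n w.val) := by
  simp only [val_mul, map_add, map_smul, smul_eq_mul]; ring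

-- Solve c(hg) = gh for c = [g,h]: the coefficient of c is the unit 1 + e(hg), which is kept on the
-- left to avoid denominators.
open scoped commutatorElement in
theorem val_commutator (g h : Fox n) :
    ((1 + e n h.val) * (1 + e n g.val)) • ⁅g, h⁆.val = e n h.val • g.val - e n g.val • h.val := by
  have H0 : ⁅g, h⁆ * (h * g) = g * h := by
    rw [commutatorElement_def]
    group
  generalize ⁅g, h⁆ = c at H0 ⊢
  funext i
  have H := congrFun (congrArg Fox.val H0) i
  have H1 := one_add_e_mul h g
  rw [val_mul, val_mul g h] at H
  simp only [Pi.add_apply, Pi.smul_apply, Pi.sub_apply, smul_eq_mul, ← H1] at H ⊢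
  rw [val_mul h g] at H ⊢
  simp only [Pi.add_apply, Pi.smul_apply, smul_eq_mul] at H
  linear_combination H

-- Applying e to `val_commutator` makes the right side e(h)e(g) − e(g)e(h) = 0, and the unit factors
-- cancel.
open scoped commutatorElement in
theorem e_commutator (g h : Fox n) : e n ⁅g, h⁆.val = 0 := by
  have H := congrArg (e n) (val_commutator g h)
  simp only [map_smul, map_sub, smul_eq_mul] at H
  have H' : (1 + e n h.val) * (1 + e n g.val) * e n ⁅g, h⁆.val = 0 := by rw [H]; ring
  have h1 := mul_unitInv g.val
  have h2 := mul_unitInv h.val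
  calc e n ⁅g, h⁆.val = ((1 + e n g.val) * unitInv g.val) * ((1 + e n h.val) * unitInv h.val) *
        e n ⁅g, h⁆.val := by rw [h1, h2]; ring
    _ = unitInv g.val * unitInv h.val *
        ((1 + e n h.val) * (1 + e n g.val) * e n ⁅g, h⁆.val) := by ring
    _ = 0 := by rw [H', mul_zero]

/-- The subgroup of the vectors on which `e` vanishes; it is commutative. -/
def kerE (n : ℕ) : Subgroup (Fox n) where
  carrier := {v | e n v.val = 0}
  one_mem' := by simp [val_one]
  mul_mem' {a b} ha hb := by
    simp only [Set.mem_ofPred_eq] at ha hb ⊢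
    simp [val_mul, ha, hb]
  inv_mem' {a} ha := by
    simp only [Set.mem_ofPred_eq] at ha ⊢
    simp [val_inv, ha]

theorem mem_kerE {v : Fox n} : v ∈ kerE n ↔ e n v.val = 0 := Iff.rfl

theorem commute_of_mem_kerE {v w : Fox n} (hv : v ∈ kerE n) (hw : w ∈ kerE n) :
    v * w = w * v := by
  rw [mem_kerE] at hv hw
  ext1
  simp [val_mul, hv, hw, add_comm]

/-- On the kernel of e the group law is addition, and commutators lie there. This metabelian
property lets the Fox derivatives descend to `FM n`. -/
theorem commutator_commutator_eq_bot :
    ⁅commutator (Fox n), commutator (Fox n)⁆ = ⊥ := by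
  have h : commutator (Fox n) ≤ kerE n := by
    rw [commutator_def, Subgroup.commutator_le]
    exact fun g _ h _ => e_commutator g h
  rw [eq_bot_iff, Subgroup.commutator_le]
  intro g hg k hk
  rw [Subgroup.mem_bot, commutatorElement_eq_one_iff_mul_comm]
  exact commute_of_mem_kerE (h hg) (h hk)

/-- The subgroup of the vectors divisible by `t ^ k`. -/
def fil (n k : ℕ) : Subgroup (Fox n) where
  carrier := {v | ∀ i, PowerSeries.X ^ k ∣ v.val i}
  one_mem' i := by simp [val_one]
  mul_mem' {a b} ha hb i := by
    simp only [val_mul, Pi.add_apply, Pi.smul_apply, smul_eq_mul]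
    exact dvd_add (dvd_add (ha i) (hb i)) (Dvd.dvd.mul_left (ha i) _)
  inv_mem' {a} ha i := by
    simp only [val_inv, Pi.neg_apply, Pi.smul_apply, smul_eq_mul]
    exact (dvd_neg).2 (Dvd.dvd.mul_left (ha i) _)

/-- The vector of the coefficients of `t ^ k`. -/
def lead (k : ℕ) (v : Fox n) : W n := fun i => PowerSeries.coeff k (v.val i)

theorem coeff_mul_of_dvd {R : Type*} [CommRing R] {k : ℕ} {a b : PowerSeries R}
    (h : PowerSeries.X ^ k ∣ a) :
    PowerSeries.coeff k (a * b) = PowerSeries.coeff k a * PowerSeries.constantCoeff b := by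
  obtain ⟨c, rfl⟩ := h
  have h1 := PowerSeries.coeff_X_pow_mul (c * b) k 0
  have h2 := PowerSeries.coeff_X_pow_mul c k 0
  rw [zero_add] at h1 h2
  rw [mul_assoc, h1, h2]
  simp

theorem e_dvd {k : ℕ} {v : Fox n} (hv : v ∈ fil n k) : PowerSeries.X ^ (k + 1) ∣ e n v.val := by
  rw [e_apply, pow_succ']
  exact mul_dvd_mul_left _ (Finset.dvd_sum fun i _ => Dvd.dvd.mul_left (hv i) _)

theorem coeff_e {k : ℕ} (v : Fox n) :
    PowerSeries.coeff (k + 1) (e n v.val) = euler n (lead k v) := by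
  rw [e_apply, PowerSeries.coeff_succ_X_mul, map_sum, euler_apply]
  simp [lead]

/-- The cross term e(w)v is divisible by t^(k+1), because e carries a factor t. -/
theorem lead_mul {k : ℕ} {v w : Fox n} (hv : v ∈ fil n k) :
    lead k (v * w) = lead k v + lead k w := by
  ext1 i
  simp only [lead, val_mul, Pi.add_apply, Pi.smul_apply, smul_eq_mul, map_add]
  rw [mul_comm, coeff_mul_of_dvd (hv i), constantCoeff_e, mul_zero, add_zero]

theorem lead_eq_zero {k : ℕ} {v : Fox n} (hv : v ∈ fil n (k + 1)) : lead k v = 0 := by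
  ext1 i
  exact PowerSeries.X_pow_dvd_iff.1 (hv i) k (Nat.lt_succ_self k)

theorem coeff_mul_dvd_dvd {R : Type*} [CommRing R] {j k : ℕ} {a b : PowerSeries R}
    (h : PowerSeries.X ^ j ∣ a) (h' : PowerSeries.X ^ k ∣ b) :
    PowerSeries.coeff (j + k) (a * b) = PowerSeries.coeff j a * PowerSeries.coeff k b := by
  obtain ⟨c, rfl⟩ := h
  obtain ⟨c', rfl⟩ := h'
  have h1 := PowerSeries.coeff_X_pow_mul (c * c') (j + k) 0
  have h2 := PowerSeries.coeff_X_pow_mul c j 0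
  have h3 := PowerSeries.coeff_X_pow_mul c' k 0
  rw [zero_add] at h1 h2 h3
  rw [show PowerSeries.X ^ j * c * (PowerSeries.X ^ k * c') =
    PowerSeries.X ^ (j + k) * (c * c') by ring, h1, h2, h3]
  simp

-- The extra factor t in e raises the order by one, which matches the index convention in which `gam
-- G k` is Γ(k+1).
open scoped commutatorElement in
theorem commutator_mem_fil {i j : ℕ} {g h : Fox n} (hg : g ∈ fil n i) (hh : h ∈ fil n j) :
    ⁅g, h⁆ ∈ fil n (i + j + 1) := by
  intro l
  have H := congrFun (val_commutator g h) l
  simp only [Pi.smul_apply, Pi.sub_apply, smul_eq_mul] at H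
  have h1 := mul_unitInv g.val
  have h2 := mul_unitInv h.val
  have e1 : ⁅g, h⁆.val l = unitInv g.val * unitInv h.val *
      (e n h.val * g.val l - e n g.val * h.val l) := by
    rw [← H]
    calc ⁅g, h⁆.val l = ((1 + e n g.val) * unitInv g.val) * ((1 + e n h.val) * unitInv h.val) *
        ⁅g, h⁆.val l := by rw [h1, h2]; ring
      _ = _ := by ring
  rw [e1]
  refine Dvd.dvd.mul_left (dvd_sub ?_ ?_) _
  · have := mul_dvd_mul (e_dvd hh) (hg l)
    rwa [← pow_add, show j + 1 + i = i + j + 1 by ring] at this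
  · have := mul_dvd_mul (e_dvd hg) (hh l)
    rwa [← pow_add, show i + 1 + j = i + j + 1 by ring] at this

-- The unit factors in `val_commutator` have constant term 1, so they do not affect leading
-- coefficients.
open scoped commutatorElement in
theorem lead_commutator {i j : ℕ} {g h : Fox n} (hg : g ∈ fil n i) (hh : h ∈ fil n j) :
    lead (i + j + 1) ⁅g, h⁆ =
      euler n (lead j h) • lead i g - euler n (lead i g) • lead j h := by
  ext1 l
  have H := congrArg (PowerSeries.coeff (i + j + 1)) (congrFun (val_commutator g h) l)
  simp only [Pi.smul_apply, Pi.sub_apply, smul_eq_mul, map_sub] at H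
  rw [mul_comm, coeff_mul_of_dvd (commutator_mem_fil hg hh l)] at H
  have h1 := coeff_mul_dvd_dvd (e_dvd hh) (hg l)
  have h2 := coeff_mul_dvd_dvd (e_dvd hg) (hh l)
  rw [show j + 1 + i = i + j + 1 by ring] at h1
  rw [show i + 1 + j = i + j + 1 by ring] at h2
  rw [h1, h2, coeff_e, coeff_e] at H
  simpa [constantCoeff_e, lead] using H

end Fox

/-! ### Fox derivatives on the Chen Lie algebra -/

/-- The homomorphism of the free group that maps a word to the vector of its Fox derivatives. -/
def foxFree (n : ℕ) : FreeGroup (Fin n) →* Fox n := FreeGroup.lift fun i => ⟨Pi.single i 1⟩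

theorem commutator_le_ker_foxFree (n : ℕ) :
    ⁅commutator (FreeGroup (Fin n)), commutator (FreeGroup (Fin n))⁆ ≤ (foxFree n).ker := by
  have h1 : (commutator (FreeGroup (Fin n))).map (foxFree n) ≤ commutator (Fox n) := by
    rw [commutator_def, Subgroup.map_commutator, commutator_def]
    exact Subgroup.commutator_mono le_top le_top
  rw [← (Subgroup.map_eq_bot_iff _), Subgroup.map_commutator, eq_bot_iff,
    ← Fox.commutator_commutator_eq_bot]
  exact Subgroup.commutator_mono h1 h1

/-- The homomorphism of the free metabelian group to the group of vectors of Fox derivatives. -/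
def fox (n : ℕ) : FM n →* Fox n :=
  QuotientGroup.lift _ (foxFree n) (commutator_le_ker_foxFree n)

theorem fox_gen (n : ℕ) (i : Fin n) :
    fox n (QuotientGroup.mk (FreeGroup.of i)) = ⟨Pi.single i 1⟩ := by
  rw [fox, QuotientGroup.lift_mk, foxFree, FreeGroup.lift_apply_of]

theorem fox_mem_fil {n : ℕ} (k : ℕ) : ∀ {g : FM n}, g ∈ LCS.gam (FM n) k → fox n g ∈ Fox.fil n k := by
  induction k with
  | zero => intro g _ i; simp
  | succ k ih =>
    intro g hg
    suffices h : LCS.gam (FM n) (k + 1) ≤ (Fox.fil n (k + 1)).comap (fox n) from h hg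
    change ⁅LCS.gam (FM n) k, (⊤ : Subgroup (FM n))⁆ ≤ _
    rw [Subgroup.commutator_le]
    intro a ha b _
    rw [Subgroup.mem_comap, map_commutatorElement]
    exact Fox.commutator_mem_fil (j := 0) (ih ha) (fun i => by simp)

/-- The leading terms of the Fox derivatives, in degree `k`. -/
def leadPiece (n k : ℕ) : LCS.Piece (FM n) k →+ W n :=
  MonoidHom.toAdditiveLeft <| QuotientGroup.lift _
    { toFun := fun g => Multiplicative.ofAdd (Fox.lead k (fox n g))
      map_one' := by
        rw [Subgroup.coe_one, map_one, Fox.lead_eq_zero (one_mem _), ofAdd_zero]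
      map_mul' := fun g h => by
        rw [Subgroup.coe_mul, map_mul, Fox.lead_mul (fox_mem_fil k g.2), ofAdd_add] }
    (fun g hg => by
      change Multiplicative.ofAdd (Fox.lead k (fox n g)) = 1
      rw [Fox.lead_eq_zero (fox_mem_fil (k + 1) (Subgroup.mem_subgroupOf.1 hg)), ofAdd_zero])

/-- The map of the Chen Lie algebra to vectors of polynomials given by the leading terms of the
Fox derivatives. -/
def foxMap (n : ℕ) : LM n →ₗ[ℤ] W n :=
  (DirectSum.toAddMonoid (leadPiece n) : (⨁ k, LCS.Piece (FM n) k) →+ W n).toIntLinearMap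

theorem foxMap_cls {n k : ℕ} (g : FM n) (hg : g ∈ LCS.gam (FM n) k) :
    foxMap n (LCS.cls k g hg) = Fox.lead k (fox n g) := by
  change (DirectSum.toAddMonoid (leadPiece n)) (DirectSum.of _ k _) = _
  rw [DirectSum.toAddMonoid_of]
  rfl

theorem foxMap_gen {n : ℕ} (i : Fin n) : foxMap n (gen n i) = Pi.single i 1 := by
  refine (foxMap_cls (k := 0) _ (Subgroup.mem_top _)).trans ?_
  rw [fox_gen]
  ext1 j
  by_cases h : j = i
  · subst h; simp [Fox.lead]
  · simp [Fox.lead, h]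

/-- By biadditivity it is enough to treat classes of group elements, where this is the leading term
of the Fox derivatives of a group commutator. -/
theorem foxMap_lie {n : ℕ} (x y : LM n) :
    foxMap n ⁅x, y⁆ =
      euler n (foxMap n y) • foxMap n x - euler n (foxMap n x) • foxMap n y := by
  induction x using LCS.gr_induction with
  | zero => simp
  | add a b ha hb => rw [add_lie, map_add, ha, hb, map_add, map_add]; module
  | hom i g hg =>
    induction y using LCS.gr_induction with
    | zero => simp
    | add a b ha hb => rw [lie_add, map_add, ha, hb, map_add, map_add]; module
    | hom j h hh =>
      rw [LCS.lie_cls, foxMap_cls, foxMap_cls, foxMap_cls, map_commutatorElement,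
        Fox.lead_commutator (fox_mem_fil i hg) (fox_mem_fil j hh)]

end Chen

/-! ### Generation of the graded Lie ring in degree one -/

namespace LCS

open scoped commutatorElement

variable {G : Type*} [Group G]

theorem cls_inv {k : ℕ} {g : G} (hg : g ∈ gam G k) :
    cls k g⁻¹ (inv_mem hg) = -cls k g hg := by
  rw [eq_neg_iff_add_eq_zero, ← cls_mul (inv_mem hg) hg]
  exact cls_eq_zero (inv_mul_cancel g)

/-- Each term of the lower central series is generated by commutators of the previous term with the
group, and taking classes turns products into sums. -/
theorem part_succ_le_of_lie {k : ℕ} {K : Submodule ℤ (Gr G)}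
    (h : ∀ x ∈ part G k, ∀ y ∈ part G 0, ⁅x, y⁆ ∈ K) : part G (k + 1) ≤ K := by
  intro x hx
  obtain ⟨g, hg, rfl⟩ := mem_part hx
  clear hx
  suffices h : ∀ hg' : g ∈ gam G (k + 1), cls (k + 1) g hg' ∈ K from h hg
  have hg0 := (Subgroup.mem_lowerCentralSeries_succ_iff (S := ⊤) k g).1 hg
  clear hg
  induction hg0 using Subgroup.closure_induction with
  | mem g hg =>
    obtain ⟨p, hp, q, -, rfl⟩ := hg
    intro h'
    have hq : q ∈ gam G 0 := Subgroup.mem_top q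
    rw [show cls (k + 1) ⁅p, q⁆ h' = ⁅cls k p hp, cls 0 q hq⁆ from (lie_cls hp hq).symm]
    exact h _ (cls_mem _ _ _) _ (cls_mem _ _ _)
  | one => intro h; rw [cls_eq_zero rfl]; exact zero_mem _
  | mul a b ha' hb' ha hb =>
    intro h
    have ha'' : a ∈ gam G (k + 1) := ha'
    have hb'' : b ∈ gam G (k + 1) := hb'
    rw [show cls (k + 1) (a * b) h = _ from cls_mul ha'' hb'']
    exact add_mem (ha ha'') (hb hb'')
  | inv a ha' ha =>
    intro h
    have ha'' : a ∈ gam G (k + 1) := ha'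
    rw [show cls (k + 1) a⁻¹ h = _ from cls_inv ha'']
    exact neg_mem (ha ha'')

theorem iSup_part : ⨆ k, part G k = ⊤ := by
  rw [eq_top_iff]
  intro x _
  induction x using gr_induction with
  | zero => exact zero_mem _
  | hom k g hg => exact Submodule.mem_iSup_of_mem k (cls_mem k g hg)
  | add a b ha hb => exact add_mem (ha trivial) (hb trivial)

end LCS

namespace Chen

variable {n : ℕ}

theorem gen_mem_part (i : Fin n) : gen n i ∈ LCS.part (FM n) 0 := LCS.cls_mem 0 _ _

theorem part_zero_le {K : Submodule ℤ (LM n)} (h : ∀ j, gen n j ∈ K) :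
    LCS.part (FM n) 0 ≤ K := by
  intro x hx
  obtain ⟨g, hg, rfl⟩ := LCS.mem_part hx
  clear hx
  obtain ⟨w, rfl⟩ := QuotientGroup.mk_surjective g
  suffices H : ∀ hg' : (QuotientGroup.mk w : FM n) ∈ LCS.gam (FM n) 0,
      LCS.cls 0 (QuotientGroup.mk w : FM n) hg' ∈ K from H hg
  clear hg
  have top : ∀ g : FM n, g ∈ LCS.gam (FM n) 0 := fun g => Subgroup.mem_top g
  induction w using FreeGroup.induction_on with
  | C1 => intro h1; rw [LCS.cls_eq_zero (hg := h1) rfl]; exact zero_mem _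
  | of i => intro _; exact h i
  | inv_of i _ =>
    intro _
    have := neg_mem (h i)
    rwa [gen, ← LCS.cls_inv (top _)] at this
  | mul a b ha hb =>
    intro _
    have := add_mem (ha (top _)) (hb (top _))
    rwa [← LCS.cls_mul (top _) (top _)] at this

theorem part_succ_le {k : ℕ} {K : Submodule ℤ (LM n)}
    (h : ∀ x ∈ LCS.part (FM n) k, ∀ j, ⁅x, gen n j⁆ ∈ K) : LCS.part (FM n) (k + 1) ≤ K := by
  refine LCS.part_succ_le_of_lie fun x hx y hy => ?_
  exact part_zero_le (K := K.comap (LieModule.toEnd ℤ (LM n) (LM n) x)) (fun j => h x hx j) hy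

/-- The Chen Lie algebra is generated by its generators. -/
theorem eq_top_of_gen_mem {K : Submodule ℤ (LM n)} (hg : ∀ j, gen n j ∈ K)
    (h : ∀ x ∈ K, ∀ j, ⁅x, gen n j⁆ ∈ K) : K = ⊤ := by
  rw [eq_top_iff, ← LCS.iSup_part, iSup_le_iff]
  intro k
  induction k with
  | zero => exact part_zero_le hg
  | succ k ih => exact part_succ_le fun x hx j => h x (ih hx) j

theorem single_isHomogeneous_zero (i l : Fin n) :
    ((Pi.single i 1 : W n) l).IsHomogeneous 0 := by
  by_cases h : l = i
  · subst h; simpa using MvPolynomial.isHomogeneous_one _ _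
  · simpa [h] using MvPolynomial.isHomogeneous_zero _ _ _

/-- The vectors of homogeneous polynomials of degree `k`. -/
def homW (n k : ℕ) : Submodule ℤ (W n) where
  carrier := {w | ∀ i, (w i).IsHomogeneous k}
  add_mem' h h' i := (h i).add (h' i)
  zero_mem' i := MvPolynomial.isHomogeneous_zero _ _ _
  smul_mem' c w h i := by
    have := (MvPolynomial.isHomogeneous_C (Fin n) c).mul (h i)
    rw [zero_add] at this
    rwa [Pi.smul_apply, MvPolynomial.smul_eq_C_mul]

theorem foxMap_lie_gen (x : LM n) (j : Fin n) :
    foxMap n ⁅x, gen n j⁆ = (MvPolynomial.X j : MvPolynomial (Fin n) ℤ) • foxMap n x -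
      Pi.single j (euler n (foxMap n x)) := by
  rw [foxMap_lie, foxMap_gen, euler_single, mul_one, ← Pi.single_smul, smul_eq_mul, mul_one]

theorem foxMap_mem_homW (k : ℕ) : ∀ x ∈ LCS.part (FM n) k, foxMap n x ∈ homW n k := by
  change LCS.part (FM n) k ≤ (homW n k).comap (foxMap n)
  induction k with
  | zero =>
    refine part_zero_le fun j => ?_
    rw [Submodule.mem_comap, foxMap_gen]
    exact single_isHomogeneous_zero j
  | succ k ih =>
    refine part_succ_le fun x hx j => ?_
    have h := ih hx
    rw [Submodule.mem_comap] at h ⊢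
    rw [foxMap_lie_gen]
    refine sub_mem (fun l => ?_) (fun l => ?_)
    · have := (MvPolynomial.isHomogeneous_X ℤ j).mul (h l)
      rwa [add_comm] at this
    · by_cases hl : l = j
      · subst hl
        rw [Pi.single_eq_same, euler_apply]
        refine MvPolynomial.IsHomogeneous.sum _ _ _ fun i _ => ?_
        have := (MvPolynomial.isHomogeneous_X ℤ i).mul (h i)
        rwa [add_comm] at this
      · rw [Pi.single_eq_of_ne hl]; exact MvPolynomial.isHomogeneous_zero _ _ _

/-! ### The part of degree at least two as a module over the polynomial ring -/

/-- The part of the Chen Lie algebra of degree at least two. -/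
def N (n : ℕ) : Submodule ℤ (LM n) := ⨆ k, LCS.part (FM n) (k + 1)

theorem part_le_N (k : ℕ) : LCS.part (FM n) (k + 1) ≤ N n :=
  le_iSup (fun k => LCS.part (FM n) (k + 1)) k

theorem euler_foxMap_lie (x y : LM n) : euler n (foxMap n ⁅x, y⁆) = 0 := by
  rw [foxMap_lie, map_sub, map_smul, map_smul, smul_eq_mul, smul_eq_mul]; ring

theorem euler_foxMap_of_mem_N {x : LM n} (hx : x ∈ N n) : euler n (foxMap n x) = 0 := by
  suffices h : N n ≤ LinearMap.ker ((euler n).restrictScalars ℤ ∘ₗ foxMap n) from h hx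
  refine iSup_le fun k => part_succ_le fun x _ j => ?_
  exact euler_foxMap_lie x (gen n j)

theorem lie_mem_N (x y : LM n) : ⁅x, y⁆ ∈ N n := by
  have hx : x ∈ ⨆ k, LCS.part (FM n) k := by rw [LCS.iSup_part]; trivial
  have hy : y ∈ ⨆ k, LCS.part (FM n) k := by rw [LCS.iSup_part]; trivial
  induction hx using Submodule.iSup_induction' with
  | zero => rw [zero_lie]; exact zero_mem _
  | add a b _ _ ha hb => rw [add_lie]; exact add_mem ha hb
  | mem i x hx =>
    induction hy using Submodule.iSup_induction' with
    | zero => rw [lie_zero]; exact zero_mem _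
    | add a b _ _ ha hb => rw [lie_add]; exact add_mem ha hb
    | mem j y hy => exact part_le_N (i + j) (LCS.lie_mem_part hx hy)

open scoped commutatorElement in
theorem FM_commutator_commute {g h : FM n} (hg : g ∈ commutator (FM n))
    (hh : h ∈ commutator (FM n)) : ⁅g, h⁆ = 1 := by
  let π : FreeGroup (Fin n) →* FM n := QuotientGroup.mk' _
  have hs : Function.Surjective π := QuotientGroup.mk'_surjective _
  have e : commutator (FM n) = (commutator (FreeGroup (Fin n))).map π := by
    have h := Subgroup.map_commutator (⊤ : Subgroup (FreeGroup (Fin n))) ⊤ π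
    rw [← MonoidHom.range_eq_map, MonoidHom.range_eq_top.2 hs] at h
    exact h.symm
  rw [e] at hg hh
  obtain ⟨a, ha, rfl⟩ := hg
  obtain ⟨b, hb, rfl⟩ := hh
  rw [← map_commutatorElement]
  exact (QuotientGroup.eq_one_iff _).2 (Subgroup.commutator_mem_commutator ha hb)

/-- Homogeneous elements of `N` are classes of elements of the commutator subgroup, which commute in
a metabelian group. -/
theorem lie_eq_zero_of_mem_N {x y : LM n} (hx : x ∈ N n) (hy : y ∈ N n) : ⁅x, y⁆ = 0 := by
  have hc : ∀ k, LCS.gam (FM n) (k + 1) ≤ commutator (FM n) := fun k =>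
    LCS.gam_anti (show 1 ≤ k + 1 by omega)
  unfold N at hx hy
  induction hx using Submodule.iSup_induction' with
  | zero => rw [zero_lie]
  | add a b _ _ ha hb => rw [add_lie, ha, hb, add_zero]
  | mem i x hx =>
    induction hy using Submodule.iSup_induction' with
    | zero => rw [lie_zero]
    | add a b _ _ ha hb => rw [lie_add, ha, hb, add_zero]
    | mem j y hy =>
      obtain ⟨g, hg, rfl⟩ := LCS.mem_part hx
      obtain ⟨h, hh, rfl⟩ := LCS.mem_part hy
      rw [LCS.lie_cls]
      exact LCS.cls_eq_zero (FM_commutator_commute (hc i hg) (hc j hh))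

/-- The operator `v ↦ [v, x_j]` on the part of degree at least two. -/
def adR (j : Fin n) : Module.End ℤ (N n) where
  toFun v := ⟨⁅(v : LM n), gen n j⁆, lie_mem_N _ _⟩
  map_add' _ _ := Subtype.ext (add_lie _ _ _)
  map_smul' c v := Subtype.ext (smul_lie c (v : LM n) (gen n j))

theorem adR_coe (j : Fin n) (v : N n) : ((adR j v : N n) : LM n) = ⁅(v : LM n), gen n j⁆ := rfl

/-- By the Jacobi identity the two orders differ by the bracket of v with [x_j, x_i], and both
elements lie in the abelian part `N`. -/
theorem adR_comm (i j : Fin n) : adR i * adR j = adR (n := n) j * adR i := by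
  refine LinearMap.ext fun v => Subtype.ext ?_
  change ⁅⁅(v : LM n), gen n j⁆, gen n i⁆ = ⁅⁅(v : LM n), gen n i⁆, gen n j⁆
  rw [lie_lie, lie_eq_zero_of_mem_N v.2 (lie_mem_N (gen n j) (gen n i)), zero_sub, lie_skew]

open scoped IsMulCommutative in
/-- The action of the polynomial ring on the part of degree at least two. -/
def act (n : ℕ) : MvPolynomial (Fin n) ℤ →ₐ[ℤ] Module.End ℤ (N n) :=
  haveI := Algebra.isMulCommutative_adjoin ℤ (s := Set.range (adR (n := n))) (by
    rintro _ ⟨i, rfl⟩ _ ⟨j, rfl⟩; exact adR_comm i j)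
  (Algebra.adjoin ℤ (Set.range (adR (n := n)))).val.comp
    (MvPolynomial.aeval fun i => ⟨adR i, Algebra.subset_adjoin ⟨i, rfl⟩⟩)

theorem act_X (j : Fin n) : act n (MvPolynomial.X j) = adR j := by
  simp [act]

/-- On `N` the correction term in `foxMap_lie_gen` vanishes, because `euler` is zero there;
bracketing with x_j is then multiplication by X_j. -/
theorem foxMap_act (p : MvPolynomial (Fin n) ℤ) (v : N n) :
    foxMap n (act n p v : N n) = p • foxMap n v := by
  induction p using MvPolynomial.induction_on generalizing v with
  | C a =>
    rw [show MvPolynomial.C a = algebraMap ℤ (MvPolynomial (Fin n) ℤ) a from rfl,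
      AlgHom.commutes, algebraMap_smul]
    simp
  | add p q hp hq => simp [hp, hq, add_smul]
  | mul_X p i hp =>
    rw [map_mul, Module.End.mul_apply, hp, act_X, adR_coe, foxMap_lie_gen,
      euler_foxMap_of_mem_N v.2, Pi.single_zero, sub_zero, smul_smul]

/-- The bracket of two generators. -/
def lieGen (i j : Fin n) : N n := ⟨⁅gen n i, gen n j⁆, lie_mem_N _ _⟩

theorem lieGen_skew (i j : Fin n) : lieGen i j = -lieGen j i :=
  Subtype.ext (lie_skew _ _).symm

theorem lieGen_self (i : Fin n) : lieGen i i = 0 := Subtype.ext (lie_self _)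

theorem lie_lie_sub_lie_lie {L : Type*} [LieRing L] (x y z : L) :
    ⁅⁅x, z⁆, y⁆ - ⁅⁅y, z⁆, x⁆ = ⁅⁅x, y⁆, z⁆ := by
  have h := lie_jacobi x y z
  rw [← lie_skew ⁅x, z⁆, ← lie_skew ⁅y, z⁆, ← lie_skew ⁅x, y⁆, ← lie_skew x z, lie_neg]
  rw [← sub_eq_zero, ← h]
  abel

/-- The Jacobi identity read in the module: the Koszul relation among three generators. -/
theorem act_lieGen_jacobi (i j k : Fin n) :
    act n (MvPolynomial.X j) (lieGen i k) - act n (MvPolynomial.X i) (lieGen j k) =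
      act n (MvPolynomial.X k) (lieGen i j) := by
  apply Subtype.ext
  rw [act_X, act_X, act_X, AddSubgroupClass.coe_sub, adR_coe, adR_coe, adR_coe]
  exact lie_lie_sub_lie_lie _ _ _

end Chen

namespace Chen

variable {n : ℕ}

open MvPolynomial

/-! ### Injectivity of the leading terms of the Fox derivatives -/

/-- The vector `X_j e_i - X_i e_j`, the image of `[x_i, x_j]`. -/
def omega (i j : Fin n) : W n := Pi.single i (X j) - Pi.single j (X i)

theorem foxMap_lieGen (i j : Fin n) : foxMap n (lieGen i j) = omega i j := by
  change foxMap n ⁅gen n i, gen n j⁆ = _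
  rw [foxMap_lie_gen, foxMap_gen, euler_single, mul_one, ← Pi.single_smul, smul_eq_mul, mul_one]
  rfl

theorem monomial_smul_omega (m : Fin n →₀ ℕ) (i j : Fin n) :
    (monomial m 1 : MvPolynomial (Fin n) ℤ) • omega i j =
      Pi.single i (monomial (m + Finsupp.single j 1) 1) -
        Pi.single j (monomial (m + Finsupp.single i 1) 1) := by
  rw [omega, smul_sub, ← Pi.single_smul, ← Pi.single_smul, smul_eq_mul, smul_eq_mul, X, X,
    monomial_mul, monomial_mul, one_mul]

theorem span_act_lieGen : Submodule.span ℤ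
    {v : N n | ∃ (m : Fin n →₀ ℕ) (i j : Fin n), v = act n (monomial m 1) (lieGen i j)} = ⊤ := by
  set K := Submodule.span ℤ
    {v : N n | ∃ (m : Fin n →₀ ℕ) (i j : Fin n), v = act n (monomial m 1) (lieGen i j)} with hK
  have h1 : ∀ v ∈ K, ∀ j, adR j v ∈ K := by
    intro v hv j
    suffices h : K ≤ K.comap (adR j) from h hv
    rw [hK, Submodule.span_le]
    rintro _ ⟨m, i, l, rfl⟩
    refine Submodule.subset_span ⟨m + Finsupp.single j 1, i, l, ?_⟩
    rw [← act_X, ← Module.End.mul_apply, ← map_mul, X, monomial_mul, one_mul, add_comm]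
  have h2 : N n ≤ K.map (N n).subtype := by
    refine iSup_le fun k => ?_
    induction k with
    | zero =>
      refine part_succ_le fun x hx j => ?_
      suffices h : LCS.part (FM n) 0 ≤ (K.map (N n).subtype).comap
          (LieModule.toEnd ℤ (LM n) (LM n) (gen n j)) by
        rw [← lie_skew]; exact neg_mem (h hx)
      refine part_zero_le fun i => ?_
      refine ⟨lieGen j i, Submodule.subset_span ⟨0, j, i, ?_⟩, rfl⟩
      simp
    | succ k ih =>
      refine part_succ_le fun x hx j => ?_
      obtain ⟨v, hv, rfl⟩ := ih hx
      exact ⟨adR j v, h1 v hv j, rfl⟩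
  rw [eq_top_iff]
  intro v _
  obtain ⟨w, hw, e⟩ := h2 v.2
  rwa [← Subtype.ext e]

open Classical in
/-- The value of `rho` on the vector whose only entry is the monomial `P` in position `i`. -/
def rhoMon (i : Fin n) (P : Fin n →₀ ℕ) : N n :=
  if h : ∃ q, q < i ∧ P q ≠ 0 ∧ ∀ j, P j ≠ 0 → q ≤ j then
    act n (monomial (P - Finsupp.single h.choose 1) 1) (lieGen i h.choose)
  else 0

/-- The rule behind the left inverse: strip the least variable X_q of the monomial and put the
bracket [x_i, x_q] in its place, provided q < i. The hypotheses say that X_q is the least variable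
of the product. -/
theorem rhoMon_eq {i q : Fin n} {P : Fin n →₀ ℕ} (hq : q < i) (h : ∀ j, P j ≠ 0 → q ≤ j) :
    rhoMon i (P + Finsupp.single q 1) = act n (monomial P 1) (lieGen i q) := by
  have H : ∃ q', q' < i ∧ (P + Finsupp.single q 1 : Fin n →₀ ℕ) q' ≠ 0 ∧
      ∀ j, (P + Finsupp.single q 1 : Fin n →₀ ℕ) j ≠ 0 → q' ≤ j := by
    refine ⟨q, hq, by simp, fun j hj => ?_⟩
    by_cases e : q = j
    · exact e.le
    · exact h j (by simpa [Finsupp.single_apply, e] using hj)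
  have e : H.choose = q := by
    obtain ⟨-, h2, h3⟩ := H.choose_spec
    refine le_antisymm (h3 q (by simp)) ?_
    by_cases e : q = H.choose
    · exact e.le
    · exact h _ fun h0 => h2 (by rw [Finsupp.add_apply, h0, Finsupp.single_eq_of_ne' e, add_zero])
  rw [rhoMon, dif_pos H, e, add_tsub_cancel_right]

theorem rhoMon_eq_zero {i : Fin n} {P : Fin n →₀ ℕ} (h : ∀ q < i, P q = 0) :
    rhoMon i P = 0 := by
  rw [rhoMon, dif_neg]
  rintro ⟨q, h1, h2, -⟩
  exact h2 (h q h1)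

theorem exists_eq_add_single_min {P : Fin n →₀ ℕ} (h : P ≠ 0) :
    ∃ q m, P = m + Finsupp.single q 1 ∧ ∀ j, P j ≠ 0 → q ≤ j := by
  have hs : P.support.Nonempty := Finsupp.support_nonempty_iff.2 h
  refine ⟨P.support.min' hs, P - Finsupp.single (P.support.min' hs) 1, ?_, fun j hj => ?_⟩
  · rw [tsub_add_cancel_of_le]
    rw [Finsupp.single_le_iff]
    exact Nat.one_le_iff_ne_zero.2 (Finsupp.mem_support_iff.1 (Finset.min'_mem _ _))
  · exact Finset.min'_le _ _ (Finsupp.mem_support_iff.2 hj)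

/-- If m has no variable below j, the first term strips X_j and the second is zero. Otherwise both
terms strip the same least variable X_q of m, and the Koszul relation for i, j, q combines them. -/
theorem rhoMon_sub_of_lt (m : Fin n →₀ ℕ) {i j : Fin n} (hij : j < i) :
    rhoMon i (m + Finsupp.single j 1) - rhoMon j (m + Finsupp.single i 1) =
      act n (monomial m 1) (lieGen i j) := by
  by_cases h : ∀ q < j, m q = 0
  · rw [rhoMon_eq hij fun l hl => not_lt.1 fun h' => hl (h l h'), rhoMon_eq_zero, sub_zero]
    intro q hq
    rw [Finsupp.add_apply, h q hq, Finsupp.single_eq_of_ne (hq.trans hij).ne, add_zero]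
  · push Not at h
    obtain ⟨p, hp, hm⟩ := h
    obtain ⟨q, m', rfl, hq⟩ := exists_eq_add_single_min (P := m) (by rintro rfl; simp at hm)
    have hqj : q < j := (hq p hm).trans_lt hp
    have hm' : ∀ l, m' l ≠ 0 → q ≤ l := fun l hl => hq l (by simp [hl])
    have hm'' : ∀ a, q < a → ∀ l, (m' + Finsupp.single a 1 : Fin n →₀ ℕ) l ≠ 0 → q ≤ l := by
      intro a ha l hl
      by_cases e : a = l
      · exact e ▸ ha.le
      · exact hm' l (by simpa [Finsupp.single_apply, e] using hl)
    rw [add_right_comm, rhoMon_eq (hqj.trans hij) (hm'' j hqj), add_right_comm,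
      rhoMon_eq hqj (hm'' i (hqj.trans hij))]
    have e : ∀ a, (monomial (m' + Finsupp.single a 1) 1 : MvPolynomial (Fin n) ℤ) =
        monomial m' 1 * X a := fun a => by rw [X, monomial_mul, one_mul]
    rw [e, e, e, map_mul, map_mul, map_mul, Module.End.mul_apply, Module.End.mul_apply,
      Module.End.mul_apply, ← act_lieGen_jacobi i j q, map_sub]

theorem rhoMon_sub (m : Fin n →₀ ℕ) (i j : Fin n) :
    rhoMon i (m + Finsupp.single j 1) - rhoMon j (m + Finsupp.single i 1) =
      act n (monomial m 1) (lieGen i j) := by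
  rcases lt_trichotomy i j with h | rfl | h
  · rw [lieGen_skew, map_neg, ← rhoMon_sub_of_lt m h, neg_sub]
  · rw [lieGen_self, map_zero, sub_self]
  · exact rhoMon_sub_of_lt m h

/-- A left inverse of `foxMap` on the part of degree at least two. -/
def rho (n : ℕ) : W n →ₗ[ℤ] N n :=
  ∑ i, (basisMonomials (Fin n) ℤ).constr ℤ (rhoMon i) ∘ₗ LinearMap.proj i

theorem rho_single (i : Fin n) (P : Fin n →₀ ℕ) :
    rho n (Pi.single i (monomial P 1)) = rhoMon i P := by
  rw [rho, LinearMap.sum_apply, Finset.sum_eq_single i]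
  · have := (basisMonomials (Fin n) ℤ).constr_basis ℤ (rhoMon i) P
    rw [coe_basisMonomials] at this
    simpa using this
  · intro j _ hj
    simp [hj]
  · simp

/-- It suffices to check the spanning elements m[x_i,x_j], where the claim is `rhoMon_sub`. -/
theorem rho_foxMap (v : N n) : rho n (foxMap n v) = v := by
  have h : v ∈ (⊤ : Submodule ℤ (N n)) := trivial
  rw [← span_act_lieGen] at h
  induction h using Submodule.span_induction with
  | zero => simp
  | add x y _ _ hx hy => rw [Submodule.coe_add, map_add, map_add, hx, hy]
  | smul c x _ hx => rw [Submodule.coe_smul, map_smul, map_smul, hx]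
  | mem x hx =>
    obtain ⟨m, i, j, rfl⟩ := hx
    rw [foxMap_act, foxMap_lieGen, monomial_smul_omega, map_sub, rho_single, rho_single,
      rhoMon_sub]

theorem constantCoeff_foxMap_of_mem_N {x : LM n} (hx : x ∈ N n) (i : Fin n) :
    coeff 0 (foxMap n x i) = 0 := by
  suffices h : N n ≤ LinearMap.ker ((lcoeff ℤ 0 ∘ₗ LinearMap.proj i : W n →ₗ[ℤ] ℤ) ∘ₗ foxMap n)
    from h hx
  refine iSup_le fun k x hx => ?_
  have := foxMap_mem_homW _ x hx i
  exact this.coeff_eq_zero (by simp)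

theorem foxMap_injective : Function.Injective (foxMap n) := by
  rw [injective_iff_map_eq_zero]
  intro x hx
  -- Split off the degree one part: its coefficients are the constant terms of the Fox vector, hence
  -- zero, and then `rho` handles the remainder in `N`.
  have hd : ∃ (c : Fin n → ℤ), x - ∑ i, c i • gen n i ∈ N n := by
    let K : Submodule ℤ (LM n) := Submodule.span ℤ (Set.range (gen n)) ⊔ N n
    have hK : K = ⊤ := eq_top_of_gen_mem
      (fun j => Submodule.mem_sup_left (Submodule.subset_span ⟨j, rfl⟩))
      (fun x _ j => Submodule.mem_sup_right (lie_mem_N _ _))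
    have hxK : x ∈ K := hK ▸ trivial
    obtain ⟨y, hy, z, hz, rfl⟩ := Submodule.mem_sup.1 hxK
    obtain ⟨c, rfl⟩ := (Submodule.mem_span_range_iff_exists_fun ℤ).1 hy
    exact ⟨c, by simpa using hz⟩
  obtain ⟨c, hc⟩ := hd
  have hc0 : ∀ j, c j = 0 := by
    intro j
    have := constantCoeff_foxMap_of_mem_N hc j
    rw [map_sub, hx, zero_sub, map_sum, Pi.neg_apply, coeff_neg, neg_eq_zero,
      Finset.sum_apply, coeff_sum, Finset.sum_eq_single j] at this
    · rw [map_smul, foxMap_gen, Pi.smul_apply, Pi.single_eq_same, coeff_smul, coeff_zero_one,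
        smul_eq_mul, mul_one] at this
      exact this
    · intro i _ hi
      simp [foxMap_gen, hi.symm]
    · simp
  simp only [hc0, zero_smul, Finset.sum_const_zero, sub_zero] at hc
  have := rho_foxMap ⟨x, hc⟩
  rw [hx, map_zero] at this
  exact (congrArg Subtype.val this).symm

end Chen

namespace Chen

variable {n : ℕ}

open MvPolynomial

/-! ### Derivations as matrices of polynomials -/

theorem derPlus_apply_mem_N (D : LCS.derPlus (FM n)) (x : LM n) :
    (D : LieDerivation ℤ (LM n) (LM n)) x ∈ N n := by
  obtain ⟨D, hD⟩ := D
  change D ∈ ⨆ k : ℕ, LCS.derDeg (FM n) (k + 1) at hD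
  change D x ∈ N n
  have hx : x ∈ ⨆ k, LCS.part (FM n) k := by rw [LCS.iSup_part]; trivial
  induction hD using Submodule.iSup_induction' with
  | zero => exact zero_mem _
  | add a b _ _ ha hb => exact add_mem ha hb
  | mem k D hD =>
    induction hx using Submodule.iSup_induction' with
    | zero => rw [map_zero]; exact zero_mem _
    | add a b _ _ ha hb => rw [map_add]; exact add_mem ha hb
    | mem i x hx => exact part_le_N (i + k) (LCS.derDeg_apply_mem hD i x hx)

/-- The matrix of a derivation of positive degree: its columns are the images of the values on the
generators. -/
def mat (n : ℕ) : LCS.derPlus (FM n) →ₗ[ℤ] Matrix (Fin n) (Fin n) (MvPolynomial (Fin n) ℤ) where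
  toFun D := Matrix.of fun p i => foxMap n ((D : LieDerivation ℤ (LM n) (LM n)) (gen n i)) p
  map_add' D E := by
    ext1 p i
    simp [Matrix.of_apply]
  map_smul' c D := by
    ext1 p i
    simp [Matrix.of_apply]

theorem mat_apply (D : LCS.derPlus (FM n)) (p i : Fin n) :
    mat n D p i = foxMap n ((D : LieDerivation ℤ (LM n) (LM n)) (gen n i)) p := rfl

/-- Both sides agree on generators. The agreement survives bracketing with a generator because
`euler` vanishes on the values of D, so the Leibniz rule loses the terms in which a coefficient is
differentiated. -/
theorem foxMap_derPlus_apply (D : LCS.derPlus (FM n)) (x : LM n) :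
    foxMap n ((D : LieDerivation ℤ (LM n) (LM n)) x) = (mat n D).mulVec (foxMap n x) := by
  suffices h : LinearMap.eqLocus (foxMap n ∘ₗ (D : LieDerivation ℤ (LM n) (LM n)).toLinearMap)
      ((mat n D).mulVecLin.restrictScalars ℤ ∘ₗ foxMap n) = ⊤ by
    have hx : x ∈ (⊤ : Submodule ℤ (LM n)) := trivial
    rw [← h] at hx
    exact hx
  refine eq_top_of_gen_mem (fun j => ?_) (fun x hx j => ?_)
  · change foxMap n ((D : LieDerivation ℤ (LM n) (LM n)) (gen n j)) =
      (mat n D).mulVec (foxMap n (gen n j))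
    rw [foxMap_gen, Matrix.mulVec_single_one]
    rfl
  · change foxMap n ((D : LieDerivation ℤ (LM n) (LM n)) x) = (mat n D).mulVec (foxMap n x) at hx
    change foxMap n ((D : LieDerivation ℤ (LM n) (LM n)) ⁅x, gen n j⁆) =
      (mat n D).mulVec (foxMap n ⁅x, gen n j⁆)
    have hj : foxMap n ((D : LieDerivation ℤ (LM n) (LM n)) (gen n j)) =
        (mat n D).mulVec (foxMap n (gen n j)) := by
      rw [foxMap_gen, Matrix.mulVec_single_one]
      rfl
    rw [LieDerivation.apply_lie_eq_add, map_add, foxMap_lie, foxMap_lie, foxMap_lie,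
      euler_foxMap_of_mem_N (derPlus_apply_mem_N D x),
      euler_foxMap_of_mem_N (derPlus_apply_mem_N D (gen n j)), hx, hj, zero_smul, zero_smul,
      zero_sub, sub_zero, Matrix.mulVec_sub, Matrix.mulVec_smul, Matrix.mulVec_smul]
    abel

theorem mat_injective : Function.Injective (mat n) := by
  intro D E h
  refine Subtype.ext (LieDerivation.ext fun x => foxMap_injective ?_)
  rw [foxMap_derPlus_apply, foxMap_derPlus_apply, h]

/-- Composition of derivations corresponds to the product of matrices, by `foxMap_derPlus_apply`. -/
theorem mat_lie (D E : LCS.derPlus (FM n)) :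
    mat n ⁅D, E⁆ = mat n D * mat n E - mat n E * mat n D := by
  ext1 p i
  rw [mat_apply, LieSubalgebra.coe_bracket, LieDerivation.lie_apply, map_sub,
    foxMap_derPlus_apply D ((E : LieDerivation ℤ (LM n) (LM n)) (gen n i)),
    foxMap_derPlus_apply E ((D : LieDerivation ℤ (LM n) (LM n)) (gen n i)),
    Pi.sub_apply, Matrix.sub_apply,
    Matrix.mul_apply, Matrix.mul_apply]
  simp only [Matrix.mulVec, dotProduct, mat_apply]

/-- The derivation that maps `x_r` to `v` and the other generators to zero. -/
def derCol (r : Fin n) (v : N n) : LieDerivation ℤ (LM n) (LM n) where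
  toFun x := act n (foxMap n x r) v
  map_add' x y := by simp
  map_smul' c x := by simp
  leibniz' x y := by
    -- The Leibniz rule is verified in the polynomial model, where the values in `N` contribute no
    -- `euler` terms.
    apply foxMap_injective
    change foxMap n (act n (foxMap n ⁅x, y⁆ r) v) = foxMap n
      (⁅x, ((act n (foxMap n y r) v : N n) : LM n)⁆ - ⁅y, ((act n (foxMap n x r) v : N n) : LM n)⁆)
    rw [map_sub, foxMap_lie x y, foxMap_lie x ((act n (foxMap n y r) v : N n) : LM n),
      foxMap_lie y ((act n (foxMap n x r) v : N n) : LM n),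
      euler_foxMap_of_mem_N (act n (foxMap n y r) v).2,
      euler_foxMap_of_mem_N (act n (foxMap n x r) v).2, foxMap_act, foxMap_act, foxMap_act,
      zero_smul, zero_smul, Pi.sub_apply, Pi.smul_apply, Pi.smul_apply,
      smul_smul, smul_smul, sub_smul, smul_eq_mul, smul_eq_mul]
    abel

theorem derCol_apply (r : Fin n) (v : N n) (x : LM n) :
    derCol r v x = (act n (foxMap n x r) v : N n) := rfl

theorem derCol_gen_same (r : Fin n) (v : N n) : derCol r v (gen n r) = v := by
  rw [derCol_apply, foxMap_gen, Pi.single_eq_same, map_one, Module.End.one_apply]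

theorem derCol_gen_of_ne {r i : Fin n} (h : r ≠ i) (v : N n) : derCol r v (gen n i) = 0 := by
  rw [derCol_apply, foxMap_gen, Pi.single_eq_of_ne h, map_zero, LinearMap.zero_apply]
  rfl

theorem derCol_mem_derDeg (r : Fin n) {k : ℕ} {v : N n} (hv : (v : LM n) ∈ LCS.part (FM n) k) :
    derCol r v ∈ LCS.derDeg (FM n) k := by
  suffices h : LCS.part (FM n) 0 ≤ (LCS.part (FM n) k).comap (derCol r v).toLinearMap from
    fun x hx => h hx
  refine part_zero_le fun j => ?_
  change derCol r v (gen n j) ∈ LCS.part (FM n) k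
  by_cases h : r = j
  · subst h; rwa [derCol_gen_same]
  · rw [derCol_gen_of_ne h]; exact zero_mem _

theorem derCol_mem_derPlus (r : Fin n) (v : N n) : derCol r v ∈ LCS.derPlus (FM n) := by
  change derCol r v ∈ ⨆ k : ℕ, LCS.derDeg (FM n) (k + 1)
  obtain ⟨v, hv⟩ := v
  unfold N at hv
  induction hv using Submodule.iSup_induction' with
  | zero =>
    convert! zero_mem (⨆ k : ℕ, LCS.derDeg (FM n) (k + 1))
    ext x
    exact congrArg Subtype.val (map_zero (act n (foxMap n x r)))
  | add a b ha hb ha' hb' =>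
    convert! add_mem ha' hb'
    ext x
    exact congrArg Subtype.val (map_add (act n (foxMap n x r)) (⟨a, ha⟩ : N n) ⟨b, hb⟩)
  | mem k x hx => exact Submodule.mem_iSup_of_mem k (derCol_mem_derDeg r hx)

/-- `derCol` as a linear map to the derivations of positive degree. -/
def derColPlus (r : Fin n) : N n →ₗ[ℤ] LCS.derPlus (FM n) where
  toFun v := ⟨derCol r v, derCol_mem_derPlus r v⟩
  map_add' v w := Subtype.ext <| LieDerivation.ext fun x =>
    congrArg Subtype.val (map_add (act n (foxMap n x r)) v w)
  map_smul' c v := Subtype.ext <| LieDerivation.ext fun x =>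
    congrArg Subtype.val (map_smul (act n (foxMap n x r)) c v)

theorem derColPlus_coe (r : Fin n) (v : N n) :
    (derColPlus r v : LieDerivation ℤ (LM n) (LM n)) = derCol r v := rfl

theorem mat_derColPlus (r : Fin n) (v : N n) :
    mat n (derColPlus r v) = Matrix.vecMulVec (foxMap n v) (Pi.single r 1) := by
  ext1 p i
  rw [mat_apply, derColPlus_coe, Matrix.vecMulVec_apply]
  by_cases h : r = i
  · subst h; rw [derCol_gen_same, Pi.single_eq_same, mul_one]
  · rw [derCol_gen_of_ne h, Pi.single_eq_of_ne' h, mul_zero, map_zero, Pi.zero_apply]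

theorem sum_derColPlus (D : LCS.derPlus (FM n)) :
    ∑ r, derColPlus r ⟨_, derPlus_apply_mem_N D (gen n r)⟩ = D := by
  apply mat_injective
  ext1 p i
  rw [map_sum, Matrix.sum_apply, Finset.sum_eq_single i]
  · rw [mat_derColPlus, Matrix.vecMulVec_apply, Pi.single_eq_same, mul_one]
    rfl
  · intro j _ hj
    rw [mat_derColPlus, Matrix.vecMulVec_apply, Pi.single_eq_of_ne' hj, mul_zero]
  · simp

/-! ### Elementary derivations and their brackets -/

/-- The derivation that maps `x_r` to `f [x_p, x_q]` and the other generators to zero. -/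
def elemDer (f : MvPolynomial (Fin n) ℤ) (p q r : Fin n) : LCS.derPlus (FM n) :=
  derColPlus r (act n f (lieGen p q))

theorem mat_elemDer (f : MvPolynomial (Fin n) ℤ) (p q r : Fin n) :
    mat n (elemDer f p q r) = Matrix.vecMulVec (f • omega p q) (Pi.single r 1) := by
  rw [elemDer, mat_derColPlus, foxMap_act, foxMap_lieGen]

theorem elemDer_skew (f : MvPolynomial (Fin n) ℤ) (p q r : Fin n) :
    elemDer f p q r = -elemDer f q p r := by
  rw [elemDer, lieGen_skew, map_neg, map_neg]; rfl

theorem elemDer_self (f : MvPolynomial (Fin n) ℤ) (p r : Fin n) : elemDer f p p r = 0 := by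
  rw [elemDer, lieGen_self, map_zero, map_zero]

theorem omega_apply_left {p q : Fin n} (h : p ≠ q) : omega p q p = X q := by
  simp [omega, h]

theorem omega_apply_right {p q : Fin n} (h : p ≠ q) : omega p q q = -X p := by
  simp [omega, h.symm]

theorem omega_apply_of_ne {p q r : Fin n} (h : r ≠ p) (h' : r ≠ q) : omega p q r = 0 := by
  simp [omega, h, h']

/-- The matrices have rank one, so each product is again of rank one, scaled by one entry of a
Koszul vector. -/
theorem elemDer_lie (f g : MvPolynomial (Fin n) ℤ) (p q r s t u : Fin n) :
    ⁅elemDer f p q r, elemDer g s t u⁆ =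
      elemDer (f * g * omega s t r) p q u - elemDer (f * g * omega p q u) s t r := by
  apply mat_injective
  rw [map_sub, mat_lie]
  simp only [mat_elemDer, Matrix.vecMulVec_mul_vecMulVec]
  ext1 a b
  simp only [Matrix.sub_apply, Matrix.vecMulVec_apply, Pi.smul_apply, smul_eq_mul,
    single_dotProduct, one_mul]
  ring

theorem trace_elemDer (f : MvPolynomial (Fin n) ℤ) (p q r : Fin n) :
    (mat n (elemDer f p q r)).trace = f * omega p q r := by
  rw [mat_elemDer, Matrix.trace_vecMulVec]
  simp

/-- The conceptual reason why the trace maps descend to the abelianization. -/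
theorem trace_mat_lie (D E : LCS.derPlus (FM n)) : (mat n ⁅D, E⁆).trace = 0 := by
  rw [mat_lie, Matrix.trace_sub, Matrix.trace_mul_comm, sub_self]

theorem span_elemDer : Submodule.span ℤ
    {D : LCS.derPlus (FM n) | ∃ (m : Fin n →₀ ℕ) (p q r : Fin n), D = elemDer (monomial m 1) p q r} =
      ⊤ := by
  rw [eq_top_iff]
  intro D _
  rw [← sum_derColPlus D]
  refine Submodule.sum_mem _ fun r _ => ?_
  generalize (⟨_, derPlus_apply_mem_N D (gen n r)⟩ : N n) = v
  have hv : v ∈ (⊤ : Submodule ℤ (N n)) := trivial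
  rw [← span_act_lieGen] at hv
  suffices h : Submodule.span ℤ
      {v : N n | ∃ (m : Fin n →₀ ℕ) (i j : Fin n), v = act n (monomial m 1) (lieGen i j)} ≤
      Submodule.comap (derColPlus r) (Submodule.span ℤ
    {D : LCS.derPlus (FM n) | ∃ (m : Fin n →₀ ℕ) (p q r : Fin n),
      D = elemDer (monomial m 1) p q r}) from h hv
  rw [Submodule.span_le]
  rintro _ ⟨m, p, q, rfl⟩
  exact Submodule.subset_span ⟨m, p, q, r, rfl⟩

theorem act_monomial_mem_part (m : Fin n →₀ ℕ) : ∀ {k : ℕ} {v : N n},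
    (v : LM n) ∈ LCS.part (FM n) k →
      ((act n (monomial m 1) v : N n) : LM n) ∈ LCS.part (FM n) (k + m.degree) := by
  induction m using Finsupp.induction_linear with
  | zero => intro k v hv; simpa using hv
  | add a b ha hb =>
    intro k v hv
    have := hb (ha hv)
    rwa [← Module.End.mul_apply, ← map_mul, monomial_mul, one_mul, add_comm b a, add_assoc,
      ← map_add] at this
  | single i c =>
    induction c with
    | zero => intro k v hv; simpa using hv
    | succ c ih =>
      intro k v hv
      have h := LCS.lie_mem_part (ih hv) (gen_mem_part i)
      rw [← adR_coe, ← act_X, ← Module.End.mul_apply, ← map_mul, X, monomial_mul, one_mul,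
        ← Finsupp.single_add, Finsupp.degree_single, add_comm 1 c] at h
      rwa [Finsupp.degree_single, ← add_assoc]

theorem elemDer_mem_derDeg (m : Fin n →₀ ℕ) (p q r : Fin n) :
    (elemDer (monomial m 1) p q r : LieDerivation ℤ (LM n) (LM n)) ∈
      LCS.derDeg (FM n) (m.degree + 1) := by
  refine derCol_mem_derDeg r ?_
  rw [add_comm]
  have h := LCS.lie_mem_part (gen_mem_part p) (gen_mem_part q)
  rw [zero_add, zero_add] at h
  exact act_monomial_mem_part (v := lieGen p q) m h

end Chen

namespace Chen

variable {n : ℕ}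

open MvPolynomial

/-! ### Additive functions on the derivations of positive degree that vanish on brackets -/

theorem monomial_add_single_one (m : Fin n →₀ ℕ) (a : Fin n) :
    (monomial (m + Finsupp.single a 1) 1 : MvPolynomial (Fin n) ℤ) = monomial m 1 * X a := by
  rw [X, monomial_mul, one_mul]

section

variable {A : Type*} [AddCommGroup A] {c : LCS.derPlus (FM n) →+ A}

theorem map_elemDer_of_ne [Nontrivial (Fin n)] (hc : ∀ D E : LCS.derPlus (FM n), c ⁅D, E⁆ = 0)
    (f : MvPolynomial (Fin n) ℤ) (a : Fin n) {p q u : Fin n} (hp : u ≠ p)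
    (hq : u ≠ q) : c (elemDer (f * X a) p q u) = 0 := by
  obtain ⟨r, hr⟩ := exists_ne a
  -- Entry r of the Koszul vector of (r,a) is X_a, and entry u of that of (p,q) is zero, so the
  -- bracket is a single elementary derivation.
  have h := elemDer_lie f 1 p q r r a u
  rw [omega_apply_of_ne hp hq, omega_apply_left hr, mul_zero, mul_one] at h
  have h0 : elemDer (0 : MvPolynomial (Fin n) ℤ) r a r = 0 := by
    rw [elemDer, map_zero, LinearMap.zero_apply, map_zero]
  rw [h0, sub_zero] at h
  rw [← h, hc]

/-- The two derivations have the same trace f X_a X_j, and their difference is the bracket of x_s ↦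
f[x_i,x_j] with x_i ↦ [x_s,x_a]. -/
theorem map_elemDer_exchange (hc : ∀ D E : LCS.derPlus (FM n), c ⁅D, E⁆ = 0)
    (f : MvPolynomial (Fin n) ℤ) {i j s a : Fin n} (hij : i ≠ j)
    (hsa : s ≠ a) : c (elemDer (f * X a) i j i) = c (elemDer (f * X j) s a s) := by
  have h := elemDer_lie f 1 i j s s a i
  rw [omega_apply_left hij, omega_apply_left hsa, mul_one] at h
  rw [← sub_eq_zero, ← map_sub, ← h, hc]

/-- If j ≠ j', the variable X_j' divides M and one exchange suffices. If j = j', only the index i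
changes, and two exchanges through an auxiliary pair (b,a) do it; the variable X_a is taken from M,
which is why M must be nontrivial. -/
theorem map_elemDer_congr [Nontrivial (Fin n)] (hc : ∀ D E : LCS.derPlus (FM n), c ⁅D, E⁆ = 0)
    {M M' : Fin n →₀ ℕ} {i j i' j' : Fin n} (hij : i ≠ j) (hij' : i' ≠ j')
    (hM : M ≠ 0) (e : M + Finsupp.single j 1 = M' + Finsupp.single j' 1) :
    c (elemDer (monomial M 1) i j i) = c (elemDer (monomial M' 1) i' j' i') := by
  by_cases h : j = j'
  · subst h
    obtain rfl : M = M' := add_right_cancel e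
    obtain ⟨a, m, rfl, -⟩ := exists_eq_add_single_min hM
    obtain ⟨b, hb⟩ := exists_ne a
    rw [monomial_add_single_one, map_elemDer_exchange hc _ hij hb,
      ← map_elemDer_exchange hc _ hij' hb]
  · have h1 : Finsupp.single j' 1 ≤ M := by
      rw [Finsupp.single_le_iff]
      have := DFunLike.congr_fun e j'
      simp [h] at this
      omega
    obtain ⟨m, rfl⟩ := exists_add_of_le h1
    have h2 : M' = m + Finsupp.single j 1 := by
      rw [add_comm _ m, add_right_comm] at e
      exact (add_right_cancel e).symm
    rw [h2, add_comm _ m, monomial_add_single_one, monomial_add_single_one,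
      map_elemDer_exchange hc _ hij hij']

open Classical in
/-- The value at any elementary derivation whose trace is the given monomial. -/
def sigmaMon (c : LCS.derPlus (FM n) →+ A) (P : Fin n →₀ ℕ) : A :=
  if h : ∃ t : Fin n × Fin n × (Fin n →₀ ℕ), t.1 ≠ t.2.1 ∧ t.2.2 ≠ 0 ∧
      P = t.2.2 + Finsupp.single t.2.1 1 then
    c (elemDer (monomial h.choose.2.2 1) h.choose.1 h.choose.2.1 h.choose.1)
  else 0

theorem sigmaMon_eq [Nontrivial (Fin n)] (hc : ∀ D E : LCS.derPlus (FM n), c ⁅D, E⁆ = 0)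
    {M : Fin n →₀ ℕ} {i j : Fin n} (hij : i ≠ j) (hM : M ≠ 0) :
    sigmaMon c (M + Finsupp.single j 1) = c (elemDer (monomial M 1) i j i) := by
  have H : ∃ t : Fin n × Fin n × (Fin n →₀ ℕ), t.1 ≠ t.2.1 ∧ t.2.2 ≠ 0 ∧
      M + Finsupp.single j 1 = t.2.2 + Finsupp.single t.2.1 1 := ⟨(i, j, M), hij, hM, rfl⟩
  rw [sigmaMon, dif_pos H]
  obtain ⟨h1, h2, h3⟩ := H.choose_spec
  exact map_elemDer_congr hc h1 hij h2 h3.symm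

/-- The map of the polynomials whose composition with the trace is `c` in degrees at least two. -/
def sigma (c : LCS.derPlus (FM n) →+ A) : MvPolynomial (Fin n) ℤ →ₗ[ℤ] A :=
  (basisMonomials (Fin n) ℤ).constr ℤ (sigmaMon c)

theorem sigma_monomial (P : Fin n →₀ ℕ) : sigma c (monomial P 1) = sigmaMon c P := by
  have := (basisMonomials (Fin n) ℤ).constr_basis ℤ (sigmaMon c) P
  rwa [coe_basisMonomials] at this

/-- Up to sign the trace is a monomial when r is p or q, and there `sigma` was defined to fit. In
the other case both sides vanish, the left one by `map_elemDer_of_ne`. -/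
theorem map_elemDer_eq_sigma_trace [Nontrivial (Fin n)] (hc : ∀ D E : LCS.derPlus (FM n), c ⁅D, E⁆ = 0)
    {m : Fin n →₀ ℕ} (hm : m ≠ 0) (p q r : Fin n) :
    c (elemDer (monomial m 1) p q r) =
      sigma c (mat n (elemDer (monomial m 1) p q r)).trace := by
  by_cases hpq : p = q
  · subst hpq
    rw [elemDer_self]; simp
  rw [trace_elemDer]
  by_cases hp : r = p
  · subst hp
    rw [omega_apply_left hpq, ← monomial_add_single_one, sigma_monomial, sigmaMon_eq hc hpq hm]
  by_cases hq : r = q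
  · subst hq
    rw [omega_apply_right hpq, mul_neg, ← monomial_add_single_one, map_neg, sigma_monomial,
      sigmaMon_eq hc (Ne.symm hpq) hm, ← map_neg, ← elemDer_skew]
  · obtain ⟨a, m', rfl, -⟩ := exists_eq_add_single_min hm
    rw [omega_apply_of_ne hp hq, mul_zero, map_zero, monomial_add_single_one,
      map_elemDer_of_ne hc _ _ hp hq]

/-- A derivation of positive degree is the sum of a derivation of degree one and of a
derivation in the span of the elementary derivations of higher degree. -/
theorem exists_degree_one_add (D : LCS.derPlus (FM n)) :
    ∃ D₁ D₂ : LCS.derPlus (FM n), D = D₁ + D₂ ∧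
      (D₁ : LieDerivation ℤ (LM n) (LM n)) ∈ LCS.derDeg (FM n) 1 ∧
      D₂ ∈ Submodule.span ℤ {D : LCS.derPlus (FM n) | ∃ (m : Fin n →₀ ℕ) (p q r : Fin n),
        m ≠ 0 ∧ D = elemDer (monomial m 1) p q r} := by
  have hD : D ∈ (⊤ : Submodule ℤ (LCS.derPlus (FM n))) := trivial
  rw [← span_elemDer] at hD
  induction hD using Submodule.span_induction with
  | zero => exact ⟨0, 0, by simp, zero_mem _, zero_mem _⟩
  | add x y _ _ hx hy =>
    obtain ⟨a, b, rfl, ha, hb⟩ := hx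
    obtain ⟨c, d, rfl, hc, hd⟩ := hy
    exact ⟨a + c, b + d, by abel, add_mem ha hc, add_mem hb hd⟩
  | smul k x _ hx =>
    obtain ⟨a, b, rfl, ha, hb⟩ := hx
    exact ⟨k • a, k • b, smul_add _ _ _, Submodule.smul_mem _ k ha, Submodule.smul_mem _ k hb⟩
  | mem x hx =>
    obtain ⟨m, p, q, r, rfl⟩ := hx
    by_cases hm : m = 0
    · refine ⟨_, 0, (add_zero _).symm, ?_, zero_mem _⟩
      have := elemDer_mem_derDeg m p q r
      subst hm
      rwa [show Finsupp.degree (0 : Fin n →₀ ℕ) = 0 from map_zero _, zero_add] at this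
    · exact ⟨0, _, (zero_add _).symm, zero_mem _, Submodule.subset_span ⟨m, p, q, r, hm, rfl⟩⟩

theorem map_eq_sigma_trace [Nontrivial (Fin n)] (hc : ∀ D E : LCS.derPlus (FM n), c ⁅D, E⁆ = 0)
    {D : LCS.derPlus (FM n)}
    (hD : D ∈ Submodule.span ℤ {D : LCS.derPlus (FM n) | ∃ (m : Fin n →₀ ℕ) (p q r : Fin n),
        m ≠ 0 ∧ D = elemDer (monomial m 1) p q r}) :
    c D = sigma c (mat n D).trace := by
  induction hD using Submodule.span_induction with
  | zero => simp
  | add x y _ _ hx hy => rw [map_add, map_add, Matrix.trace_add, map_add, hx, hy]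
  | smul k x _ hx => rw [map_zsmul, map_smul, Matrix.trace_smul, map_smul, hx]
  | mem x hx =>
    obtain ⟨m, p, q, r, hm, rfl⟩ := hx
    exact map_elemDer_eq_sigma_trace hc hm p q r

end

end Chen

namespace Chen

variable {n : ℕ}

open MvPolynomial

/-! ### Polynomials and symmetric powers -/

/-- The linear map that sends the generators of `H` to the variables. -/
def linX (n : ℕ) : H n →ₗ[ℤ] MvPolynomial (Fin n) ℤ := (FreeAbelianGroup.lift X).toIntLinearMap

theorem linX_of (i : Fin n) : linX n (FreeAbelianGroup.of i) = X i :=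
  FreeAbelianGroup.lift_apply_of X i

theorem basis_apply (i : Fin n) :
    FreeAbelianGroup.basis (Fin n) i = FreeAbelianGroup.of i := by
  simp [FreeAbelianGroup.basis, FreeAbelianGroup.equivFinsupp]

/-- Equal exponents mean that the fibres of u and v have equal cardinalities; bijections of the
fibres glue to a permutation. -/
theorem exists_perm_of_sum_single_eq {k : ℕ} {u v : Fin k → Fin n}
    (h : ∑ i, Finsupp.single (u i) 1 = ∑ i, (Finsupp.single (v i) 1 : Fin n →₀ ℕ)) :
    ∃ e : Equiv.Perm (Fin k), ∀ i, v (e i) = u i := by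
  have hc : ∀ w : Fin k → Fin n, ∀ a,
      Fintype.card {i // w i = a} = (∑ i, (Finsupp.single (w i) 1 : Fin n →₀ ℕ)) a := by
    intro w a
    rw [Finsupp.finsetSum_apply, Fintype.card_subtype, Finset.card_filter]
    simp [Finsupp.single_apply]
  have he : ∀ a, Nonempty ({i // u i = a} ≃ {i // v i = a}) := fun a =>
    Fintype.card_eq.1 (by rw [hc, hc, h])
  refine ⟨(Equiv.sigmaFiberEquiv u).symm.trans ((Equiv.sigmaCongrRight fun a => (he a).some).trans
    (Equiv.sigmaFiberEquiv v)), fun i => ?_⟩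
  exact (((he (u i)).some) ⟨i, rfl⟩).2

open Classical in
/-- The product in the symmetric power of the variables of a monomial of degree `k`; zero for
monomials of other degrees. -/
def symMon (k : ℕ) (P : Fin n →₀ ℕ) : Sym[ℤ]^k (H n) :=
  if h : ∃ v : Fin k → Fin n, P = ∑ i, Finsupp.single (v i) 1 then
    SymmetricPower.tprod ℤ fun i => FreeAbelianGroup.of (h.choose i)
  else 0

theorem symMon_sum {k : ℕ} (v : Fin k → Fin n) :
    symMon k (∑ i, Finsupp.single (v i) 1) =
      SymmetricPower.tprod ℤ fun i => FreeAbelianGroup.of (v i) := by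
  have H : ∃ u : Fin k → Fin n, ∑ i, Finsupp.single (v i) 1 = ∑ i, Finsupp.single (u i) 1 :=
    ⟨v, rfl⟩
  rw [symMon, dif_pos H]
  obtain ⟨e, he⟩ := exists_perm_of_sum_single_eq H.choose_spec
  rw [← SymmetricPower.tprod_equiv e]
  simp only [← he]

theorem degree_sum_single {k : ℕ} (v : Fin k → Fin n) :
    Finsupp.degree (∑ i, (Finsupp.single (v i) 1 : Fin n →₀ ℕ)) = k := by
  simp [map_sum]

theorem exists_sum_single (P : Fin n →₀ ℕ) :
    ∃ v : Fin P.degree → Fin n, P = ∑ i, Finsupp.single (v i) 1 := by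
  suffices h : ∀ k (P : Fin n →₀ ℕ), P.degree = k →
      ∃ v : Fin k → Fin n, P = ∑ i, Finsupp.single (v i) 1 from h _ P rfl
  intro k
  induction k with
  | zero =>
    intro P hP
    exact ⟨Fin.elim0, by simpa using (Finsupp.degree_eq_zero_iff P).1 hP⟩
  | succ k ih =>
    intro P hP
    obtain ⟨q, m, rfl, -⟩ := exists_eq_add_single_min (P := P) (by rintro rfl; simp at hP)
    rw [map_add, Finsupp.degree_single, Nat.add_right_cancel_iff] at hP
    obtain ⟨v, rfl⟩ := ih m hP
    exact ⟨Fin.cons q v, by rw [Fin.sum_univ_succ]; simp [add_comm]⟩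

theorem symMon_of_degree_ne {k : ℕ} {P : Fin n →₀ ℕ} (h : P.degree ≠ k) : symMon k P = 0 := by
  rw [symMon, dif_neg]
  rintro ⟨v, rfl⟩
  exact h (degree_sum_single v)

/-- The projection of the polynomials to the symmetric power of degree `k`. -/
def psi (n k : ℕ) : MvPolynomial (Fin n) ℤ →ₗ[ℤ] Sym[ℤ]^k (H n) :=
  (basisMonomials (Fin n) ℤ).constr ℤ (symMon k)

theorem psi_monomial (k : ℕ) (P : Fin n →₀ ℕ) : psi n k (monomial P 1) = symMon k P := by
  have := (basisMonomials (Fin n) ℤ).constr_basis ℤ (symMon (n := n) k) P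
  rwa [coe_basisMonomials] at this

theorem prod_X_eq_monomial {k : ℕ} (v : Fin k → Fin n) :
    ∏ i, (X (v i) : MvPolynomial (Fin n) ℤ) = monomial (∑ i, Finsupp.single (v i) 1) 1 := by
  simp only [X]
  rw [← monomial_sum_one]

/-- Both sides are multilinear in v, so the claim reduces to basis vectors and `symMon_sum`. -/
theorem psi_prod_linX {k : ℕ} (v : Fin k → H n) :
    psi n k (∏ i, linX n (v i)) = SymmetricPower.tprod ℤ v := by
  suffices h : (psi n k).compMultilinearMap
      ((MultilinearMap.mkPiAlgebra ℤ (Fin k) (MvPolynomial (Fin n) ℤ)).compLinearMap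
        fun _ => linX n) = SymmetricPower.tprod ℤ from DFunLike.congr_fun h v
  refine Module.Basis.ext_multilinear (fun _ => FreeAbelianGroup.basis (Fin n)) fun v => ?_
  simp only [basis_apply]
  change psi n k (∏ i, linX n (FreeAbelianGroup.of (v i))) = _
  simp only [linX_of]
  rw [prod_X_eq_monomial, psi_monomial, symMon_sum]
  rfl

theorem IsHomogeneous.induction_monomial {k : ℕ} {p : MvPolynomial (Fin n) ℤ}
    (hp : p.IsHomogeneous k) {K : Submodule ℤ (MvPolynomial (Fin n) ℤ)}
    (h : ∀ P : Fin n →₀ ℕ, P.degree = k → monomial P 1 ∈ K) : p ∈ K := by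
  rw [p.as_sum]
  refine Submodule.sum_mem _ fun P hP => ?_
  have e : (monomial P (coeff P p) : MvPolynomial (Fin n) ℤ) = coeff P p • monomial P 1 := by
    rw [smul_monomial, smul_eq_mul, mul_one]
  rw [e]
  refine Submodule.smul_mem _ _ (h P ?_)
  by_contra hd
  exact (mem_support_iff.1 hP) (hp.coeff_eq_zero hd)

theorem psi_of_isHomogeneous_ne {k l : ℕ} {p : MvPolynomial (Fin n) ℤ} (hp : p.IsHomogeneous l)
    (h : l ≠ k) : psi n k p = 0 := by
  refine IsHomogeneous.induction_monomial hp (K := LinearMap.ker (psi n k)) fun P hP => ?_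
  rw [LinearMap.mem_ker, psi_monomial, symMon_of_degree_ne (hP ▸ h)]

/-- The homomorphism of the symmetric power to the polynomials that sends a symmetric product to
the product of linear forms. -/
def eta (n k : ℕ) : Sym[ℤ]^k (H n) →+ MvPolynomial (Fin n) ℤ :=
  AddCon.lift _ (PiTensorProduct.lift
      ((MultilinearMap.mkPiAlgebra ℤ (Fin k) (MvPolynomial (Fin n) ℤ)).compLinearMap
        fun _ => linX n)).toAddMonoidHom <| by
    rw [AddCon.addConGen_le]
    rintro _ _ ⟨e, f⟩
    simp only [AddCon.ker_rel]
    refine (PiTensorProduct.lift.tprod _).trans (Eq.trans ?_ (PiTensorProduct.lift.tprod _).symm)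
    simp only [MultilinearMap.compLinearMap_apply, MultilinearMap.mkPiAlgebra_apply]
    exact (Equiv.prod_comp e fun i => linX n (f i)).symm

theorem eta_tprod {k : ℕ} (v : Fin k → H n) :
    eta n k (SymmetricPower.tprod ℤ v) = ∏ i, linX n (v i) := by
  refine (PiTensorProduct.lift.tprod _).trans ?_
  simp only [MultilinearMap.compLinearMap_apply, MultilinearMap.mkPiAlgebra_apply]

theorem eta_symMon (P : Fin n →₀ ℕ) : eta n P.degree (symMon P.degree P) = monomial P 1 := by
  obtain ⟨v, hv⟩ := exists_sum_single P
  generalize P.degree = k at v hv ⊢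
  subst hv
  rw [symMon_sum, eta_tprod]
  simp only [linX_of]
  exact prod_X_eq_monomial v

/-- The target of the trace maps in all degrees at least two. -/
abbrev SymSum (n : ℕ) : Type := ⨁ k : {k : ℕ // 2 ≤ k}, Sym[ℤ]^(k : ℕ) (H n)

/-- The map of the polynomials to the sum of the symmetric powers of degree at least two. -/
def psiSum (n : ℕ) : MvPolynomial (Fin n) ℤ →ₗ[ℤ] SymSum n :=
  (basisMonomials (Fin n) ℤ).constr ℤ fun P =>
    if h : 2 ≤ P.degree then
      DirectSum.of (fun k : {k : ℕ // 2 ≤ k} => Sym[ℤ]^(k : ℕ) (H n)) ⟨P.degree, h⟩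
        (symMon P.degree P)
    else 0

theorem psiSum_monomial (P : Fin n →₀ ℕ) : psiSum n (monomial P 1) =
    if h : 2 ≤ P.degree then
      DirectSum.of (fun k : {k : ℕ // 2 ≤ k} => Sym[ℤ]^(k : ℕ) (H n)) ⟨P.degree, h⟩
        (symMon P.degree P)
    else 0 := by
  have := (basisMonomials (Fin n) ℤ).constr_basis ℤ (fun P : Fin n →₀ ℕ =>
    if h : 2 ≤ P.degree then
      DirectSum.of (fun k : {k : ℕ // 2 ≤ k} => Sym[ℤ]^(k : ℕ) (H n)) ⟨P.degree, h⟩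
        (symMon P.degree P)
    else 0) P
  rwa [coe_basisMonomials] at this

theorem psiSum_of_isHomogeneous {k : ℕ} (hk : 2 ≤ k) {p : MvPolynomial (Fin n) ℤ}
    (hp : p.IsHomogeneous k) :
    psiSum n p = DirectSum.of (fun k : {k : ℕ // 2 ≤ k} => Sym[ℤ]^(k : ℕ) (H n)) ⟨k, hk⟩
      (psi n k p) := by
  suffices h : p ∈ LinearMap.eqLocus (psiSum n)
    (DirectSum.lof ℤ _ (fun k : {k : ℕ // 2 ≤ k} => Sym[ℤ]^(k : ℕ) (H n)) ⟨k, hk⟩ ∘ₗ psi n k)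
    from h
  refine IsHomogeneous.induction_monomial hp fun P hP => ?_
  subst hP
  change psiSum n _ = DirectSum.of (fun k : {k : ℕ // 2 ≤ k} => Sym[ℤ]^(k : ℕ) (H n)) _
    (psi n _ _)
  rw [psiSum_monomial, dif_pos hk, psi_monomial]

theorem psiSum_of_isHomogeneous_lt {k : ℕ} (hk : k < 2) {p : MvPolynomial (Fin n) ℤ}
    (hp : p.IsHomogeneous k) : psiSum n p = 0 := by
  refine IsHomogeneous.induction_monomial hp (K := LinearMap.ker (psiSum n)) fun P hP => ?_
  rw [LinearMap.mem_ker, psiSum_monomial, dif_neg (by omega)]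

/-- The sum of the homomorphisms `eta`. -/
def etaSum (n : ℕ) : SymSum n →+ MvPolynomial (Fin n) ℤ := DirectSum.toAddMonoid fun k => eta n k

theorem etaSum_psiSum {P : Fin n →₀ ℕ} (h : 2 ≤ P.degree) :
    etaSum n (psiSum n (monomial P 1)) = monomial P 1 := by
  rw [psiSum_monomial, dif_pos h, etaSum, DirectSum.toAddMonoid_of, eta_symMon]

/-- Stated for an arbitrary ℤ-module structure so that it applies to the scalars of
`SymmetricPower.module`. -/
theorem int_smul_mem {M : Type*} [AddCommGroup M] (inst : Module ℤ M)
    {K : AddSubgroup M} (c : ℤ) {x : M} (hx : x ∈ K) : inst.smul c x ∈ K := by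
  rw [int_smul_eq_zsmul inst c x]
  exact zsmul_mem hx c

theorem closure_tprod (k : ℕ) : AddSubgroup.closure
    (Set.range (SymmetricPower.tprod ℤ (ι := Fin k) (M := H n))) = ⊤ := by
  rw [eq_top_iff]
  intro x _
  have hx := (SymmetricPower.span_tprod_eq_top ℤ (Fin k) (H n)).ge (Submodule.mem_top (x := x))
  induction hx using Submodule.span_induction with
  | zero => exact zero_mem _
  | add x y _ _ hx hy => exact add_mem (hx trivial) (hy trivial)
  | mem x hx => exact AddSubgroup.subset_closure hx
  | smul c x _ hx =>
    exact int_smul_mem (inst := SymmetricPower.module ℤ (Fin k) (H n)) c (hx trivial)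

theorem isHomogeneous_linX (h : H n) : (linX n h).IsHomogeneous 1 := by
  induction h using FreeAbelianGroup.induction_on with
  | zero => rw [map_zero]; exact isHomogeneous_zero _ _ _
  | of i => rw [linX_of]; exact isHomogeneous_X _ _
  | neg i hi => rw [map_neg]; exact hi.neg
  | add x y hx hy => rw [map_add]; exact hx.add hy

theorem isHomogeneous_prod_linX {k : ℕ} (v : Fin k → H n) :
    (∏ i, linX n (v i)).IsHomogeneous k := by
  have := IsHomogeneous.prod Finset.univ (fun i => linX n (v i)) (fun _ => 1)
    fun i _ => isHomogeneous_linX (v i)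
  simpa using this

/-- Pure symmetric products are images of products of linear forms, and these expand into monomials
of the same degree. -/
theorem closure_psiSum_monomial {K : AddSubgroup (SymSum n)}
    (h : ∀ P : Fin n →₀ ℕ, 2 ≤ P.degree → psiSum n (monomial P 1) ∈ K) : K = ⊤ := by
  rw [eq_top_iff]
  intro x _
  induction x using DirectSum.induction_on with
  | zero => exact zero_mem _
  | add x y hx hy => exact add_mem (hx trivial) (hy trivial)
  | of k x =>
    obtain ⟨k, hk⟩ := k
    suffices h : AddSubgroup.closure
        (Set.range (SymmetricPower.tprod ℤ (ι := Fin k) (M := H n))) ≤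
        K.comap (DirectSum.of (fun k : {k : ℕ // 2 ≤ k} => Sym[ℤ]^(k : ℕ) (H n)) ⟨k, hk⟩) by
      rw [closure_tprod] at h
      exact h (AddSubgroup.mem_top x)
    rw [AddSubgroup.closure_le]
    rintro _ ⟨v, rfl⟩
    have hp := isHomogeneous_prod_linX v
    change DirectSum.of (fun k : {k : ℕ // 2 ≤ k} => Sym[ℤ]^(k : ℕ) (H n)) ⟨k, hk⟩ _ ∈ K
    rw [← psi_prod_linX, ← psiSum_of_isHomogeneous hk hp]
    exact IsHomogeneous.induction_monomial hp
      (K := (AddSubgroup.toIntSubmodule K).comap (psiSum n))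
      fun P hP => h P (hP ▸ hk)

end Chen

namespace Chen

variable {n : ℕ}

open MvPolynomial

/-! ### The trace maps factor through the Chen Lie algebra -/

/-- The universal property lifts the generators into K, and composing with the inclusion gives the
identity. -/
theorem FreeLieAlgebra.mem_of_of_mem {X : Type*} (K : LieSubalgebra ℤ (FreeLieAlgebra ℤ X))
    (h : ∀ x, FreeLieAlgebra.of ℤ x ∈ K) (a : FreeLieAlgebra ℤ X) : a ∈ K := by
  let F : FreeLieAlgebra ℤ X →ₗ⁅ℤ⁆ K := FreeLieAlgebra.lift ℤ fun x => ⟨FreeLieAlgebra.of ℤ x, h x⟩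
  have e : K.incl.comp F = LieHom.id := by
    refine FreeLieAlgebra.hom_ext fun x => ?_
    exact congrArg Subtype.val (FreeLieAlgebra.lift_of_apply
      (fun x => (⟨FreeLieAlgebra.of ℤ x, h x⟩ : K)) x)
  have h1 : ((F a : K) : FreeLieAlgebra ℤ X) = a := LieHom.congr_fun e a
  have h2 := (F a).2
  rwa [h1] at h2

/-- The map of `H` to the constant vectors. -/
def constW (n : ℕ) : H n →ₗ[ℤ] W n :=
  (FreeAbelianGroup.lift fun i => (Pi.single i 1 : W n)).toIntLinearMap

theorem constW_of (i : Fin n) : constW n (FreeAbelianGroup.of i) = Pi.single i 1 :=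
  FreeAbelianGroup.lift_apply_of _ i

theorem euler_constW (h : H n) : euler n (constW n h) = linX n h := by
  induction h using FreeAbelianGroup.induction_on with
  | zero => simp
  | of i => rw [constW_of, linX_of, euler_single, mul_one]
  | neg i hi => rw [map_neg, map_neg, map_neg, hi]
  | add x y hx hy => rw [map_add, map_add, map_add, hx, hy]

/-- The homomorphism of the tensor algebra to the symmetric algebra. -/
def symHom (n : ℕ) : TensorAlgebra ℤ (H n) →ₐ[ℤ] MvPolynomial (Fin n) ℤ :=
  TensorAlgebra.lift ℤ (linX n)

theorem symHom_ι (h : H n) : symHom n (TensorAlgebra.ι ℤ h) = linX n h :=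
  TensorAlgebra.lift_ι_apply _ _

/-- The endomorphism `(p, w) ↦ (X_h p, p h)`. -/
def shiftEnd (n : ℕ) : H n →ₗ[ℤ] Module.End ℤ (MvPolynomial (Fin n) ℤ × W n) where
  toFun h :=
    { toFun := fun x => (linX n h * x.1, x.1 • constW n h)
      map_add' := fun x y => by simp [mul_add, add_smul]
      map_smul' := fun c x => Prod.ext (mul_smul_comm c _ _) (smul_assoc c x.1 _) }
  map_add' h h' := by
    refine LinearMap.ext fun x => Prod.ext ?_ ?_
    · simp [add_mul]
    · simp
  map_smul' c h := by
    refine LinearMap.ext fun x => Prod.ext ?_ ?_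
    · change linX n (c • h) * x.1 = c • (linX n h * x.1)
      rw [map_smul, smul_mul_assoc]
    · change x.1 • constW n (c • h) = c • (x.1 • constW n h)
      rw [map_smul, smul_comm]

/-- The map `h_1 ⊗ ⋯ ⊗ h_k ↦ h_1 ⊗ (h_2 ⋯ h_k)` of the tensor algebra to the vectors of
polynomials. -/
def headTail (n : ℕ) : TensorAlgebra ℤ (H n) →ₗ[ℤ] W n :=
  LinearMap.snd ℤ _ _ ∘ₗ LinearMap.applyₗ ((1, 0) : MvPolynomial (Fin n) ℤ × W n) ∘ₗ
    (TensorAlgebra.lift ℤ (shiftEnd n)).toLinearMap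

theorem lift_shiftEnd (a : TensorAlgebra ℤ (H n)) :
    TensorAlgebra.lift ℤ (shiftEnd n) a (1, 0) = (symHom n a, headTail n a) := by
  refine Prod.ext ?_ rfl
  have key : ∀ (a : TensorAlgebra ℤ (H n)) (x : MvPolynomial (Fin n) ℤ × W n),
      (TensorAlgebra.lift ℤ (shiftEnd n) a x).1 = symHom n a * x.1 := by
    intro a
    induction a using TensorAlgebra.induction with
    | algebraMap r => intro x; simp
    | ι h => intro x; rw [TensorAlgebra.lift_ι_apply, symHom_ι]; rfl
    | mul a b ha hb => intro x; rw [map_mul, Module.End.mul_apply, ha, hb, map_mul, mul_assoc]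
    | add a b ha hb =>
      intro x; rw [map_add, LinearMap.add_apply, Prod.fst_add, ha, hb, map_add, add_mul]
  rw [key, mul_one]

theorem headTail_ι_mul (h : H n) (b : TensorAlgebra ℤ (H n)) :
    headTail n (TensorAlgebra.ι ℤ h * b) = symHom n b • constW n h := by
  change (TensorAlgebra.lift ℤ (shiftEnd n) (TensorAlgebra.ι ℤ h * b) (1, 0)).2 = _
  rw [map_mul, Module.End.mul_apply, lift_shiftEnd, TensorAlgebra.lift_ι_apply]
  rfl

theorem headTail_algebraMap (r : ℤ) :
    headTail n (algebraMap ℤ (TensorAlgebra ℤ (H n)) r) = 0 := by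
  change (TensorAlgebra.lift ℤ (shiftEnd n) (algebraMap ℤ (TensorAlgebra ℤ (H n)) r) (1, 0)).2 = _
  rw [AlgHom.commutes, Module.algebraMap_end_apply]
  simp

theorem headTail_ι (h : H n) : headTail n (TensorAlgebra.ι ℤ h) = constW n h := by
  have := headTail_ι_mul h 1
  rwa [mul_one, map_one, one_smul] at this

/-- This is the Fox product rule, with `algebraMapInv` in the role of the augmentation. -/
theorem headTail_mul (a b : TensorAlgebra ℤ (H n)) :
    headTail n (a * b) = symHom n b • headTail n a +
      TensorAlgebra.algebraMapInv a • headTail n b := by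
  induction a using TensorAlgebra.induction generalizing b with
  | algebraMap r =>
    rw [headTail_algebraMap, smul_zero, zero_add, AlgHom.commutes, ← Algebra.smul_def, map_smul]
    rfl
  | ι h =>
    rw [headTail_ι_mul, headTail_ι]
    simp [TensorAlgebra.algebraMapInv]
  | mul a a' ha ha' =>
    rw [mul_assoc, ha, ha', ha, map_mul, map_mul]
    module
  | add a a' ha ha' =>
    rw [add_mul, map_add, ha, ha', map_add, map_add]
    module

/-- The analogue of the fundamental formula of Fox calculus. It turns the factors `symHom` of the
product rule into `euler` of a vector, as in `foxMap_lie`. -/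
theorem symHom_eq (a : TensorAlgebra ℤ (H n)) :
    symHom n a = C (TensorAlgebra.algebraMapInv a) + euler n (headTail n a) := by
  induction a using TensorAlgebra.induction with
  | algebraMap r => rw [headTail_algebraMap, map_zero, add_zero, AlgHom.commutes, AlgHom.commutes]; rfl
  | ι h => rw [headTail_ι, euler_constW, symHom_ι]; simp [TensorAlgebra.algebraMapInv]
  | mul a a' ha ha' =>
    have e : ∀ (c : ℤ) (w : W n), euler n (c • w) = C c * euler n w := fun c w => by
      rw [map_zsmul, ← smul_eq_C_mul]
    rw [headTail_mul, map_add, map_smul, e, map_mul, map_mul, map_mul, smul_eq_mul, ha, ha']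
    ring
  | add a a' ha ha' =>
    rw [map_add, map_add, map_add, map_add, map_add, ha, ha']
    ring

attribute [local instance] LieRing.ofAssociativeRing LieAlgebra.ofAssociativeAlgebra

theorem iota_of (i : Fin n) :
    iota n (FreeLieAlgebra.of ℤ i) = TensorAlgebra.ι ℤ (FreeAbelianGroup.of i) :=
  FreeLieAlgebra.lift_of_apply _ _

theorem proj_of (i : Fin n) : proj n (FreeLieAlgebra.of ℤ i) = gen n i :=
  FreeLieAlgebra.lift_of_apply _ _

/-- The elements of the free Lie algebra on which the two maps to vectors of polynomials agree. -/
def agree (n : ℕ) : LieSubalgebra ℤ (L n) where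
  carrier := {a | TensorAlgebra.algebraMapInv (iota n a) = 0 ∧
    headTail n (iota n a) = foxMap n (proj n a)}
  zero_mem' := by simp
  add_mem' {a b} ha hb := by
    refine ⟨?_, ?_⟩
    · rw [map_add, map_add, ha.1, hb.1, add_zero]
    · rw [map_add, map_add, map_add, map_add, ha.2, hb.2]
  smul_mem' c a ha := by
    refine ⟨?_, ?_⟩
    · rw [map_smul, map_smul, ha.1, smul_zero]
    · rw [map_smul, map_smul, map_smul, map_smul, ha.2]
  lie_mem' {a b} ha hb := by
    refine ⟨?_, ?_⟩
    · rw [LieHom.map_lie, LieRing.of_associative_ring_bracket, map_sub, map_mul, map_mul, ha.1,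
        hb.1, mul_zero, sub_zero]
    · rw [LieHom.map_lie, LieRing.of_associative_ring_bracket, map_sub, headTail_mul, headTail_mul,
        ha.1, hb.1, zero_smul, zero_smul, add_zero, add_zero, symHom_eq, symHom_eq, ha.1, hb.1,
        C_0, zero_add, zero_add, ha.2, hb.2, LieHom.map_lie, foxMap_lie]

/-- For elements of zero augmentation, `headTail` of an associative commutator follows the bracket
rule of `foxMap`, so agreement on generators propagates. -/
theorem headTail_iota (a : L n) : headTail n (iota n a) = foxMap n (proj n a) := by
  refine (FreeLieAlgebra.mem_of_of_mem (agree n) (fun i => ⟨?_, ?_⟩) a).2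
  · rw [iota_of]; simp [TensorAlgebra.algebraMapInv]
  · rw [iota_of, proj_of, headTail_ι, constW_of, foxMap_gen]

/-- The map `f ⊗ w ↦ ∑ f(x_i) w_i` to the symmetric power of degree `k`. -/
def pairW (n k : ℕ) : Module.Dual ℤ (H n) →ₗ[ℤ] W n →ₗ[ℤ] Sym[ℤ]^k (H n) :=
  LinearMap.mk₂ ℤ (fun f w => psi n k (∑ i, f (FreeAbelianGroup.of i) • w i))
    (fun f g w => by simp [add_smul, Finset.sum_add_distrib])
    (fun c f w => by simp only [LinearMap.smul_apply, smul_assoc, ← Finset.smul_sum, map_smul])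
    (fun f v w => by simp [Finset.sum_add_distrib])
    (fun c f w => by
      simp only [Pi.smul_apply, smul_comm _ c, ← Finset.smul_sum, map_smul])

theorem pairW_apply {k : ℕ} (f : Module.Dual ℤ (H n)) (w : W n) :
    pairW n k f w = psi n k (∑ i, f (FreeAbelianGroup.of i) • w i) := rfl

theorem sum_smul_constW (f : Module.Dual ℤ (H n)) (h : H n) :
    ∑ i, f (FreeAbelianGroup.of i) • constW n h i = C (f h) := by
  induction h using FreeAbelianGroup.induction_on with
  | zero => simp
  | of j =>
    rw [constW_of, Finset.sum_eq_single j]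
    · rw [Pi.single_eq_same, smul_eq_C_mul, mul_one]
    · intro i _ hi; simp [hi]
    · simp
  | neg j hj => rw [map_neg, map_neg, C_neg, ← hj]; simp
  | add x y hx hy => rw [map_add, map_add, C_add, ← hx, ← hy]; simp [Finset.sum_add_distrib]

theorem symHom_tprod {l : ℕ} (v : Fin l → H n) :
    symHom n (TensorAlgebra.tprod ℤ (H n) l v) = ∏ i, linX n (v i) := by
  rw [TensorAlgebra.tprod_apply, map_list_prod, List.map_ofFn, List.prod_ofFn]
  exact Finset.prod_congr rfl fun i _ => symHom_ι (v i)

theorem headTail_tprod_succ {l : ℕ} (v : Fin (l + 1) → H n) :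
    headTail n (TensorAlgebra.tprod ℤ (H n) (l + 1) v) =
      (∏ i : Fin l, linX n (v i.succ)) • constW n (v 0) := by
  rw [TensorAlgebra.tprod_apply, List.ofFn_succ, List.prod_cons, headTail_ι_mul,
    ← symHom_tprod fun i : Fin l => v i.succ, TensorAlgebra.tprod_apply]

theorem pairW_smul_constW {k : ℕ} (f : Module.Dual ℤ (H n)) (p : MvPolynomial (Fin n) ℤ)
    (h : H n) : pairW n k f (p • constW n h) = f h • psi n k p := by
  rw [pairW_apply, ← map_smul (psi n k), smul_eq_C_mul, ← sum_smul_constW, Finset.sum_mul]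
  congr 1
  refine Finset.sum_congr rfl fun i _ => ?_
  rw [Pi.smul_apply, smul_eq_mul, mul_comm p, smul_mul_assoc]

theorem contr_tprod {k : ℕ} (f : Module.Dual ℤ (H n)) (v : Fin (k + 1) → H n) :
    contr n k f (PiTensorProduct.tprod ℤ v) =
      f (v 0) • PiTensorProduct.tprod ℤ fun i : Fin k => v i.succ := by
  refine (PiTensorProduct.lift.tprod _).trans ?_
  rfl

theorem mk_contr_tprod {k : ℕ} (f : Module.Dual ℤ (H n)) (v : Fin (k + 1) → H n) :
    SymmetricPower.mk ℤ (Fin k) (H n) (contr n k f (PiTensorProduct.tprod ℤ v)) =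
      f (v 0) • SymmetricPower.tprod ℤ fun i : Fin k => v i.succ := by
  rw [contr_tprod]
  exact map_smul (SymmetricPower.mk ℤ (Fin k) (H n)) _ _

/-- A tensor of length l + 1 leaves a tail of degree l, so selecting the component k + 1 on one side
matches selecting degree k by `psi` on the other. Length zero contributes nothing to either. -/
theorem pairW_headTail_tprod {k l : ℕ} (f : Module.Dual ℤ (H n)) (v : Fin l → H n) :
    SymmetricPower.mk ℤ (Fin k) (H n) (contr n k f
      (DirectSum.component ℤ ℕ (fun k => ⨂[ℤ]^k (H n)) (k + 1)
        (DirectSum.of (fun k => ⨂[ℤ]^k (H n)) l (PiTensorProduct.tprod ℤ v)))) =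
      pairW n k f (headTail n (TensorAlgebra.tprod ℤ (H n) l v)) := by
  rcases l with _ | l
  · have h : headTail n (TensorAlgebra.tprod ℤ (H n) 0 v) = 0 := by
      have := headTail_algebraMap (n := n) 1
      rw [map_one] at this
      rw [TensorAlgebra.tprod_apply, List.ofFn_zero, List.prod_nil, this]
    rw [h, map_zero]
    have h' : DirectSum.component ℤ ℕ (fun k => ⨂[ℤ]^k (H n)) (k + 1)
        (DirectSum.of (fun k => ⨂[ℤ]^k (H n)) 0 (PiTensorProduct.tprod ℤ v)) = 0 :=
      DirectSum.of_eq_of_ne (β := fun k => ⨂[ℤ]^k (H n)) 0 (k + 1) (PiTensorProduct.tprod ℤ v)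
        (Nat.succ_ne_zero k)
    rw [h', map_zero, map_zero]
  · rw [headTail_tprod_succ, pairW_smul_constW]
    by_cases hl : l = k
    · subst hl
      rw [psi_prod_linX, ← mk_contr_tprod]
      congr 2
      exact DirectSum.of_eq_same _ _
    · rw [psi_of_isHomogeneous_ne (isHomogeneous_prod_linX fun i : Fin l => v i.succ) hl, smul_zero]
      have h' : DirectSum.component ℤ ℕ (fun k => ⨂[ℤ]^k (H n)) (k + 1)
          (DirectSum.of (fun k => ⨂[ℤ]^k (H n)) (l + 1) (PiTensorProduct.tprod ℤ v)) = 0 :=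
        DirectSum.of_eq_of_ne _ _ _ (by omega)
      rw [h', map_zero, map_zero]

theorem pairW_headTail {k : ℕ} (f : Module.Dual ℤ (H n)) (a : TensorAlgebra ℤ (H n)) :
    SymmetricPower.mk ℤ (Fin k) (H n) (contr n k f
      (DirectSum.component ℤ ℕ (fun k => ⨂[ℤ]^k (H n)) (k + 1) (TensorAlgebra.equivDirectSum a))) =
      pairW n k f (headTail n a) := by
  obtain ⟨x, rfl⟩ := TensorAlgebra.equivDirectSum.symm.surjective a
  rw [AlgEquiv.apply_symm_apply]
  induction x using DirectSum.induction_on with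
  | zero => simp
  | add x y hx hy => simp only [map_add, hx, hy]
  | of l x =>
    induction x using PiTensorProduct.induction_on with
    | add x y hx hy => simp only [map_add, hx, hy]
    | smul_tprod r v =>
      rw [DirectSum.of_smul]
      simp only [map_smul]
      refine (map_smul (SymmetricPower.mk ℤ (Fin k) (H n)) r _).trans ?_
      rw [pairW_headTail_tprod, TensorAlgebra.equivDirectSum_symm_apply,
        TensorAlgebra.ofDirectSum_of_tprod]
      rfl

/-- The trace map induced on the Chen Lie algebra. -/
def traceM (n k : ℕ) : Module.Dual ℤ (H n) ⊗[ℤ] LM n →ₗ[ℤ] Sym[ℤ]^k (H n) :=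
  TensorProduct.lift ((pairW n k).compl₂ (foxMap n))

theorem traceM_tmul {k : ℕ} (f : Module.Dual ℤ (H n)) (x : LM n) :
    traceM n k (f ⊗ₜ x) = psi n k (∑ i, f (FreeAbelianGroup.of i) • foxMap n x i) := rfl

theorem traceM_comp_proj (k : ℕ) :
    traceM n k ∘ₗ (LinearMap.lTensor (Module.Dual ℤ (H n)) (proj n : L n →ₗ[ℤ] LM n)) =
      trace n k := by
  refine TensorProduct.ext' fun f a => ?_
  change pairW n k f (foxMap n (proj n a)) = SymmetricPower.mk ℤ (Fin k) (H n) (contr n k f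
      (DirectSum.component ℤ ℕ (fun k => ⨂[ℤ]^k (H n)) (k + 1)
        (TensorAlgebra.equivDirectSum (iota n a))))
  rw [pairW_headTail, headTail_iota]

/-- Pairing x_i^* with the i-th column selects the i-th diagonal entry. -/
theorem traceM_restr {k : ℕ} (D : LCS.derPlus (FM n)) :
    traceM n k (restr n D) = psi n k (mat n D).trace := by
  rw [restr, map_sum, Matrix.trace, map_sum]
  refine Finset.sum_congr rfl fun i _ => ?_
  rw [traceM_tmul]
  congr 1
  rw [Finset.sum_eq_single i, ← basis_apply]
  · simp [mat_apply]
  · intro j _ hj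
    rw [← basis_apply]
    simp [hj]
  · simp

end Chen

namespace Chen

variable {n : ℕ}

open MvPolynomial

/-! ### The degree one part -/

/-- The element `x_p ∧ x_q`. -/
def wedge (p q : Fin n) : ⋀[ℤ]^2 (H n) :=
  exteriorPower.ιMulti ℤ 2 ![FreeAbelianGroup.of p, FreeAbelianGroup.of q]

theorem wedge_self (p : Fin n) : wedge p p = 0 :=
  AlternatingMap.map_eq_zero_of_eq _ _ (i := 0) (j := 1) rfl (by decide)

theorem wedge_skew (p q : Fin n) : wedge p q = -wedge q p := by
  have h := AlternatingMap.map_swap (exteriorPower.ιMulti ℤ 2)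
    ![FreeAbelianGroup.of q, FreeAbelianGroup.of p] (i := 0) (j := 1) (by decide)
  rw [wedge, wedge, ← h]
  congr 1
  funext i
  fin_cases i <;> rfl

theorem inclH_of (i : Fin n) : inclH n (FreeAbelianGroup.of i) = gen n i :=
  FreeAbelianGroup.lift_apply_of _ i

theorem wedgeToLM_ιMulti (v : Fin 2 → H n) :
    wedgeToLM n (exteriorPower.ιMulti ℤ 2 v) = ⁅inclH n (v 0), inclH n (v 1)⁆ :=
  exteriorPower.alternatingMapLinearEquiv_apply_ιMulti _ _

theorem wedgeToLM_wedge (p q : Fin n) : wedgeToLM n (wedge p q) = lieGen p q := by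
  rw [wedge, wedgeToLM_ιMulti]
  change ⁅inclH n (FreeAbelianGroup.of p), inclH n (FreeAbelianGroup.of q)⁆ = _
  rw [inclH_of, inclH_of]
  rfl

theorem inclH_mem_part (h : H n) : inclH n h ∈ LCS.part (FM n) 0 := by
  induction h using FreeAbelianGroup.induction_on with
  | zero => rw [map_zero]; exact zero_mem _
  | of i => rw [inclH_of]; exact gen_mem_part i
  | neg i hi => rw [map_neg]; exact neg_mem hi
  | add x y hx hy => rw [map_add]; exact add_mem hx hy

theorem wedgeToLM_mem_part (t : ⋀[ℤ]^2 (H n)) : wedgeToLM n t ∈ LCS.part (FM n) 1 := by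
  have ht : t ∈ Submodule.span ℤ (Set.range (exteriorPower.ιMulti ℤ 2 (M := H n))) := by
    rw [exteriorPower.ιMulti_span]; trivial
  induction ht using Submodule.span_induction with
  | zero => rw [map_zero]; exact zero_mem _
  | add x y _ _ hx hy => rw [map_add]; exact add_mem hx hy
  | smul c x _ hx => rw [map_smul]; exact Submodule.smul_mem _ c hx
  | mem x hx =>
    obtain ⟨v, rfl⟩ := hx
    rw [wedgeToLM_ιMulti]
    have h := LCS.lie_mem_part (inclH_mem_part (v 0)) (inclH_mem_part (v 1))
    rwa [zero_add, zero_add] at h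

/-- The value of `theta` on the vector whose only entry is the monomial `P` in position `p`. -/
def thetaMon (p : Fin n) (P : Fin n →₀ ℕ) : ⋀[ℤ]^2 (H n) :=
  ∑ q, if q < p ∧ P = Finsupp.single q 1 then wedge p q else 0

theorem thetaMon_single (p q : Fin n) :
    thetaMon p (Finsupp.single q 1) = if q < p then wedge p q else 0 := by
  rw [thetaMon, Finset.sum_eq_single q]
  · simp
  · intro r _ hr
    rw [if_neg]
    rintro ⟨-, h⟩
    exact hr (Finsupp.single_left_injective one_ne_zero h).symm
  · simp

theorem thetaMon_of_degree_ne {p : Fin n} {P : Fin n →₀ ℕ} (h : P.degree ≠ 1) :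
    thetaMon p P = 0 := by
  refine Finset.sum_eq_zero fun q _ => if_neg ?_
  rintro ⟨-, rfl⟩
  exact h (Finsupp.degree_single _ _)

/-- A left inverse of `Λ²H → LM n → W n`. -/
def theta (n : ℕ) : W n →ₗ[ℤ] ⋀[ℤ]^2 (H n) :=
  ∑ i, (basisMonomials (Fin n) ℤ).constr ℤ (thetaMon i) ∘ₗ LinearMap.proj i

theorem theta_single (i : Fin n) (P : Fin n →₀ ℕ) :
    theta n (Pi.single i (monomial P 1)) = thetaMon i P := by
  rw [theta, LinearMap.sum_apply, Finset.sum_eq_single i]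
  · have := (basisMonomials (Fin n) ℤ).constr_basis ℤ (thetaMon i) P
    rw [coe_basisMonomials] at this
    simpa using this
  · intro j _ hj
    simp [hj]
  · simp

theorem theta_omega (p q : Fin n) : theta n (omega p q) = wedge p q := by
  rw [omega, map_sub, X, X, theta_single, theta_single, thetaMon_single, thetaMon_single]
  rcases lt_trichotomy p q with h | rfl | h
  · rw [if_neg h.not_gt, if_pos h, zero_sub, ← wedge_skew]
  · simp [wedge_self]
  · rw [if_pos h, if_neg h.not_gt, sub_zero]

theorem theta_of_mem_homW {k : ℕ} (hk : k ≠ 1) {w : W n} (hw : w ∈ homW n k) :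
    theta n w = 0 := by
  rw [← Finset.univ_sum_single w, map_sum]
  refine Finset.sum_eq_zero fun i _ => ?_
  refine IsHomogeneous.induction_monomial (hw i)
    (K := LinearMap.ker (theta n ∘ₗ LinearMap.single ℤ (fun _ => MvPolynomial (Fin n) ℤ) i))
    fun P hP => ?_
  change theta n (Pi.single i (monomial P 1)) = 0
  rw [theta_single, thetaMon_of_degree_ne (by omega)]

/-- Degree two is spanned by brackets of generators, where `theta_omega` applies; with
`theta_wedgeToLM` this identifies Λ²H with the degree two part. -/
theorem wedgeToLM_theta {x : LM n} (hx : x ∈ LCS.part (FM n) 1) :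
    wedgeToLM n (theta n (foxMap n x)) = x := by
  suffices h : LCS.part (FM n) (0 + 1) ≤
      LinearMap.eqLocus (wedgeToLM n ∘ₗ theta n ∘ₗ foxMap n) LinearMap.id from h hx
  refine part_succ_le fun x hx j => ?_
  suffices h : LCS.part (FM n) 0 ≤ (LinearMap.eqLocus (wedgeToLM n ∘ₗ theta n ∘ₗ foxMap n)
      LinearMap.id).comap (LieModule.toEnd ℤ (LM n) (LM n) (gen n j)) by
    rw [← lie_skew]; exact neg_mem (h hx)
  refine part_zero_le fun i => ?_
  change wedgeToLM n (theta n (foxMap n (lieGen j i))) = lieGen j i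
  rw [foxMap_lieGen, theta_omega, wedgeToLM_wedge]

theorem theta_wedgeToLM (t : ⋀[ℤ]^2 (H n)) : theta n (foxMap n (wedgeToLM n t)) = t := by
  suffices h : theta n ∘ₗ foxMap n ∘ₗ wedgeToLM n = LinearMap.id from LinearMap.congr_fun h t
  refine exteriorPower.linearMap_ext ?_
  refine Module.Basis.ext_alternating (FreeAbelianGroup.basis (Fin n)) fun v _ => ?_
  simp only [basis_apply]
  have e : exteriorPower.ιMulti ℤ 2 (fun i => FreeAbelianGroup.of (v i)) = wedge (v 0) (v 1) := by
    rw [wedge]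
    congr 1
    funext i
    fin_cases i <;> rfl
  change theta n (foxMap n (wedgeToLM n (exteriorPower.ιMulti ℤ 2
    (fun i => FreeAbelianGroup.of (v i))))) = exteriorPower.ιMulti ℤ 2 _
  rw [e, wedgeToLM_wedge, foxMap_lieGen, theta_omega]

/-! ### The isomorphism -/

/-- The value of a derivation on a generator. -/
def evalGen (i : Fin n) : LCS.derPlus (FM n) →ₗ[ℤ] LM n where
  toFun D := (D : LieDerivation ℤ (LM n) (LM n)) (gen n i)
  map_add' _ _ := rfl
  map_smul' _ _ := rfl

/-- The degree one part of a derivation. -/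
def degOne (n : ℕ) : LCS.derPlus (FM n) →ₗ[ℤ] Module.Dual ℤ (H n) ⊗[ℤ] ⋀[ℤ]^2 (H n) :=
  ∑ i, TensorProduct.mk ℤ (Module.Dual ℤ (H n)) (⋀[ℤ]^2 (H n))
    ((FreeAbelianGroup.basis (Fin n)).coord i) ∘ₗ theta n ∘ₗ foxMap n ∘ₗ evalGen i

theorem degOne_apply (D : LCS.derPlus (FM n)) : degOne n D =
    ∑ i, (FreeAbelianGroup.basis (Fin n)).coord i ⊗ₜ[ℤ]
      theta n (foxMap n ((D : LieDerivation ℤ (LM n) (LM n)) (gen n i))) := by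
  rw [degOne, LinearMap.sum_apply]
  rfl

/-- The traces of a derivation in degrees at least two. -/
def traces (n : ℕ) : LCS.derPlus (FM n) →ₗ[ℤ] SymSum n :=
  psiSum n ∘ₗ Matrix.traceLinearMap (Fin n) ℤ (MvPolynomial (Fin n) ℤ) ∘ₗ mat n

theorem traces_apply (D : LCS.derPlus (FM n)) : traces n D = psiSum n (mat n D).trace := rfl

theorem isHomogeneous_trace {k : ℕ} {D : LCS.derPlus (FM n)}
    (hD : (D : LieDerivation ℤ (LM n) (LM n)) ∈ LCS.derDeg (FM n) k) :
    (mat n D).trace.IsHomogeneous k :=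
  IsHomogeneous.sum _ _ _ fun i _ => foxMap_mem_homW k _ (hD _ (gen_mem_part i)) i

theorem lTensor_degOne {D : LCS.derPlus (FM n)}
    (hD : (D : LieDerivation ℤ (LM n) (LM n)) ∈ LCS.derDeg (FM n) 1) :
    LinearMap.lTensor (Module.Dual ℤ (H n)) (wedgeToLM n) (degOne n D) = restr n D := by
  rw [degOne_apply, map_sum, restr]
  refine Finset.sum_congr rfl fun i _ => ?_
  rw [LinearMap.lTensor_tmul, wedgeToLM_theta (hD _ (gen_mem_part i))]

theorem traces_of_degree_one {D : LCS.derPlus (FM n)}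
    (hD : (D : LieDerivation ℤ (LM n) (LM n)) ∈ LCS.derDeg (FM n) 1) : traces n D = 0 :=
  psiSum_of_isHomogeneous_lt (by norm_num) (isHomogeneous_trace hD)

theorem degOne_of_degree_ne {k : ℕ} (hk : k ≠ 1) {D : LCS.derPlus (FM n)}
    (hD : (D : LieDerivation ℤ (LM n) (LM n)) ∈ LCS.derDeg (FM n) k) : degOne n D = 0 := by
  rw [degOne_apply]
  refine Finset.sum_eq_zero fun i _ => ?_
  rw [theta_of_mem_homW hk (foxMap_mem_homW k _ (hD _ (gen_mem_part i))), TensorProduct.tmul_zero]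

theorem traces_of_degree {k : ℕ} (hk : 2 ≤ k) {D : LCS.derPlus (FM n)}
    (hD : (D : LieDerivation ℤ (LM n) (LM n)) ∈ LCS.derDeg (FM n) k) :
    traces n D = DirectSum.of (fun k : {k : ℕ // 2 ≤ k} => Sym[ℤ]^(k : ℕ) (H n)) ⟨k, hk⟩
      (traceM n k (restr n D)) := by
  rw [traces_apply, psiSum_of_isHomogeneous hk (isHomogeneous_trace hD), traceM_restr]

/-- Brackets of elementary derivations are homogeneous of degree at least two, where `degOne`
vanishes. -/
theorem degOne_lie (D E : LCS.derPlus (FM n)) : degOne n ⁅D, E⁆ = 0 := by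
  have hD : D ∈ (⊤ : Submodule ℤ (LCS.derPlus (FM n))) := trivial
  have hE : E ∈ (⊤ : Submodule ℤ (LCS.derPlus (FM n))) := trivial
  rw [← span_elemDer] at hD hE
  induction hD using Submodule.span_induction with
  | zero => rw [zero_lie, map_zero]
  | add x y _ _ hx hy => rw [add_lie, map_add, hx, hy, add_zero]
  | smul c x _ hx => rw [smul_lie, map_smul, hx, smul_zero]
  | mem x hx =>
    obtain ⟨m, p, q, r, rfl⟩ := hx
    induction hE using Submodule.span_induction with
    | zero => rw [lie_zero, map_zero]
    | add x y _ _ hx hy => rw [lie_add, map_add, hx, hy, add_zero]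
    | smul c x _ hx => rw [lie_smul, map_smul, hx, smul_zero]
    | mem x hx =>
      obtain ⟨m', p', q', r', rfl⟩ := hx
      exact degOne_of_degree_ne (by omega)
        (LCS.derDeg_lie_mem (elemDer_mem_derDeg m p q r) (elemDer_mem_derDeg m' p' q' r'))

/-- The degree one part and the traces. -/
def total (n : ℕ) : LCS.derPlus (FM n) →ₗ[ℤ]
    (Module.Dual ℤ (H n) ⊗[ℤ] ⋀[ℤ]^2 (H n)) × SymSum n :=
  (degOne n).prod (traces n)

theorem total_apply (D : LCS.derPlus (FM n)) : total n D = (degOne n D, traces n D) := rfl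

theorem total_lie (D E : LCS.derPlus (FM n)) : total n ⁅D, E⁆ = 0 := by
  rw [total_apply, degOne_lie, traces_apply, trace_mat_lie, map_zero]
  rfl

/-- Contracting the first tensor factor with x_i isolates the element of Λ²H that determines D(x_i).
-/
theorem degOne_eq_zero {D : LCS.derPlus (FM n)}
    (hD : (D : LieDerivation ℤ (LM n) (LM n)) ∈ LCS.derDeg (FM n) 1) (h : degOne n D = 0) :
    D = 0 := by
  apply mat_injective
  rw [map_zero]
  ext1 p i
  have e := congrArg ((TensorProduct.lid ℤ (⋀[ℤ]^2 (H n))).toLinearMap ∘ₗ LinearMap.rTensor (⋀[ℤ]^2 (H n))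
    (Module.Dual.eval ℤ (H n) (FreeAbelianGroup.basis (Fin n) i))) h
  rw [degOne_apply, map_sum, map_zero, Finset.sum_eq_single i] at e
  · simp only [LinearMap.comp_apply, LinearMap.rTensor_tmul, LinearEquiv.coe_coe,
      TensorProduct.lid_tmul, Module.Dual.eval_apply, Module.Basis.coord_apply,
      Module.Basis.repr_self, Finsupp.single_eq_same, one_smul] at e
    rw [mat_apply, ← wedgeToLM_theta (hD _ (gen_mem_part i)), e, map_zero, map_zero]
    rfl
  · intro j _ hj
    simp only [LinearMap.comp_apply, LinearMap.rTensor_tmul, LinearEquiv.coe_coe,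
      TensorProduct.lid_tmul, Module.Dual.eval_apply, Module.Basis.coord_apply,
      Module.Basis.repr_self, Finsupp.single_eq_of_ne hj, zero_smul]
  · exact fun h => absurd (Finset.mem_univ i) h

/-- No information is lost in passing from the polynomial trace to symmetric powers: the elementary
derivations in this span have trace zero or a signed monomial of degree at least two, which `etaSum`
recovers. -/
theorem etaSum_traces {D : LCS.derPlus (FM n)}
    (hD : D ∈ Submodule.span ℤ {D : LCS.derPlus (FM n) | ∃ (m : Fin n →₀ ℕ) (p q r : Fin n),
        m ≠ 0 ∧ D = elemDer (monomial m 1) p q r}) :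
    etaSum n (traces n D) = (mat n D).trace := by
  induction hD using Submodule.span_induction with
  | zero => simp
  | add x y _ _ hx hy => rw [map_add, map_add, map_add, Matrix.trace_add, hx, hy]
  | smul k x _ hx => rw [map_zsmul (traces n), map_zsmul, map_smul, Matrix.trace_smul, hx]
  | mem x hx =>
    obtain ⟨m, p, q, r, hm, rfl⟩ := hx
    have hd : ∀ a, 2 ≤ (m + Finsupp.single a 1).degree := by
      intro a
      have := (Finsupp.degree_eq_zero_iff m).not.2 hm
      rw [map_add, Finsupp.degree_single]
      omega
    rw [traces_apply, trace_elemDer]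
    by_cases hpq : p = q
    · subst hpq; simp [omega]
    by_cases hp : r = p
    · subst hp
      rw [omega_apply_left hpq, ← monomial_add_single_one, etaSum_psiSum (hd q)]
    by_cases hq : r = q
    · subst hq
      rw [omega_apply_right hpq, mul_neg, ← monomial_add_single_one, map_neg, map_neg,
        etaSum_psiSum (hd p)]
    · rw [omega_apply_of_ne hp hq, mul_zero, map_zero, map_zero]

/-- Vanishing of `degOne` kills the degree one summand. On the rest c factors through the trace,
which vanishes because the traces in symmetric powers do. -/
theorem map_eq_zero_of_total_eq_zero [Nontrivial (Fin n)] {A : Type*} [AddCommGroup A]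
    {c : LCS.derPlus (FM n) →+ A} (hc : ∀ D E : LCS.derPlus (FM n), c ⁅D, E⁆ = 0)
    {D : LCS.derPlus (FM n)} (h : total n D = 0) : c D = 0 := by
  obtain ⟨D₁, D₂, rfl, h1, h2⟩ := exists_degree_one_add D
  have h3 : degOne n D₂ = 0 := by
    suffices hs : Submodule.span ℤ {D : LCS.derPlus (FM n) | ∃ (m : Fin n →₀ ℕ) (p q r : Fin n),
        m ≠ 0 ∧ D = elemDer (monomial m 1) p q r} ≤ LinearMap.ker (degOne n) from hs h2
    rw [Submodule.span_le]
    rintro _ ⟨m, p, q, r, hm, rfl⟩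
    refine degOne_of_degree_ne ?_ (elemDer_mem_derDeg m p q r)
    have := (Finsupp.degree_eq_zero_iff m).not.2 hm
    omega
  have h4 : degOne n (D₁ + D₂) = 0 := congrArg Prod.fst h
  have h5 : traces n (D₁ + D₂) = 0 := congrArg Prod.snd h
  rw [map_add, h3, add_zero] at h4
  obtain rfl := degOne_eq_zero h1 h4
  rw [zero_add] at h5 ⊢
  rw [map_eq_sigma_trace hc h2, ← etaSum_traces h2, h5, map_zero, map_zero]

theorem total_surjective [Nontrivial (Fin n)] : Function.Surjective (total n) := by
  have hs : ∀ s : SymSum n, (0, s) ∈ LinearMap.range (total n) := by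
    intro s
    let K : AddSubgroup (SymSum n) := (LinearMap.range (total n)).toAddSubgroup.comap
      (AddMonoidHom.inr _ _)
    have hK : K = ⊤ := by
      refine closure_psiSum_monomial fun P hP => ?_
      obtain ⟨j, M, rfl, -⟩ := exists_eq_add_single_min (P := P) (by rintro rfl; simp at hP)
      rw [map_add, Finsupp.degree_single] at hP
      obtain ⟨i, hij⟩ := exists_ne j
      -- For i ≠ j the trace of this derivation is the monomial M times X_j, which is the prescribed
      -- one.
      refine ⟨elemDer (monomial M 1) i j i, ?_⟩
      rw [total_apply, degOne_of_degree_ne (by omega) (elemDer_mem_derDeg M i j i), traces_apply,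
        trace_elemDer, omega_apply_left hij, ← monomial_add_single_one]
      rfl
    exact (hK ▸ AddSubgroup.mem_top s : s ∈ K)
  have ht : ∀ t : Module.Dual ℤ (H n) ⊗[ℤ] ⋀[ℤ]^2 (H n), (t, 0) ∈ LinearMap.range (total n) := by
    intro t
    let K := (LinearMap.range (total n)).comap (LinearMap.inl ℤ _ (SymSum n))
    change t ∈ K
    induction t using TensorProduct.induction_on with
    | zero => exact zero_mem _
    | add x y hx hy => exact add_mem hx hy
    | tmul f t =>
      rw [← (FreeAbelianGroup.basis (Fin n)).sum_dual_apply_smul_coord f, TensorProduct.sum_tmul]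
      refine Submodule.sum_mem _ fun r _ => ?_
      rw [← TensorProduct.smul_tmul']
      refine Submodule.smul_mem _ _ ?_
      have hp := wedgeToLM_mem_part t
      let v : N n := ⟨wedgeToLM n t, part_le_N 0 hp⟩
      refine ⟨derColPlus r v, ?_⟩
      have hd : (derColPlus r v : LieDerivation ℤ (LM n) (LM n)) ∈ LCS.derDeg (FM n) 1 :=
        derCol_mem_derDeg r hp
      rw [total_apply, traces_of_degree_one hd, degOne_apply, Finset.sum_eq_single r]
      · rw [derColPlus_coe, derCol_gen_same, theta_wedgeToLM]
        rfl
      · intro j _ hj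
        rw [derColPlus_coe, derCol_gen_of_ne hj.symm, map_zero, map_zero, TensorProduct.tmul_zero]
      · simp
  rintro ⟨t, s⟩
  obtain ⟨D, hD⟩ := add_mem (ht t) (hs s)
  exact ⟨D, by simpa using hD⟩

theorem ker_total [Nontrivial (Fin n)] :
    (⁅(⊤ : LieIdeal ℤ (LCS.derPlus (FM n))), (⊤ : LieIdeal ℤ (LCS.derPlus (FM n)))⁆ :
      LieIdeal ℤ (LCS.derPlus (FM n))).toSubmodule = LinearMap.ker (total n) := by
  apply le_antisymm
  · rw [LieSubmodule.lieIdeal_oper_eq_linear_span', Submodule.span_le]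
    rintro _ ⟨D, -, E, -, rfl⟩
    exact total_lie D E
  · intro D hD
    let I : Submodule ℤ (LCS.derPlus (FM n)) :=
      (⁅(⊤ : LieIdeal ℤ (LCS.derPlus (FM n))), (⊤ : LieIdeal ℤ (LCS.derPlus (FM n)))⁆ :
        LieIdeal ℤ (LCS.derPlus (FM n))).toSubmodule
    -- The universal choice of an additive function that vanishes on brackets is the quotient map
    -- itself.
    have h := map_eq_zero_of_total_eq_zero (c := I.mkQ.toAddMonoidHom) (fun D E => ?_) hD
    · exact (Submodule.Quotient.mk_eq_zero I).1 h
    · exact (Submodule.Quotient.mk_eq_zero I).2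
        (LieSubmodule.lie_mem_lie (LieSubmodule.mem_top D) (LieSubmodule.mem_top E))

/-- The isomorphism of the abelianization with the sum of the degree one part and of the symmetric
powers. -/
def abEquiv (n : ℕ) [Nontrivial (Fin n)] : LieAb (LCS.derPlus (FM n)) ≃ₗ[ℤ]
    (Module.Dual ℤ (H n) ⊗[ℤ] ⋀[ℤ]^2 (H n)) × SymSum n :=
  (Submodule.quotEquivOfEq _ _ ker_total).trans
    ((total n).quotKerEquivOfSurjective total_surjective)

theorem abEquiv_mk [Nontrivial (Fin n)] (D : LCS.derPlus (FM n)) :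
    abEquiv n (LieSubmodule.Quotient.mk D) = total n D := rfl

end Chen

end

open TensorProduct DirectSum in
theorem mainTheorem3 (n : ℕ) (hn : 4 ≤ n) :
    ∃ TrM : ∀ k : ℕ, Module.Dual ℤ (Chen.H n) ⊗[ℤ] Chen.LM n →ₗ[ℤ] Sym[ℤ]^k (Chen.H n),
      (∀ k : ℕ, 2 ≤ k →
        TrM k ∘ₗ (LinearMap.lTensor (Module.Dual ℤ (Chen.H n))
          (Chen.proj n : Chen.L n →ₗ[ℤ] Chen.LM n)) = Chen.trace n k) ∧
      ∃ Φ : LieAb (LCS.derPlus (Chen.FM n)) ≃ₗ[ℤ]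
          (Module.Dual ℤ (Chen.H n) ⊗[ℤ] ⋀[ℤ]^2 (Chen.H n)) ×
            (⨁ k : {k : ℕ // 2 ≤ k}, Sym[ℤ]^(k : ℕ) (Chen.H n)),
        (∀ D : LCS.derPlus (Chen.FM n),
          (D : LieDerivation ℤ (Chen.LM n) (Chen.LM n)) ∈ LCS.derDeg (Chen.FM n) 1 →
            LinearMap.lTensor (Module.Dual ℤ (Chen.H n)) (Chen.wedgeToLM n)
                (Φ (LieSubmodule.Quotient.mk D)).1 = Chen.restr n D ∧
              (Φ (LieSubmodule.Quotient.mk D)).2 = 0) ∧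
        (∀ (k : ℕ) (hk : 2 ≤ k) (D : LCS.derPlus (Chen.FM n)),
          (D : LieDerivation ℤ (Chen.LM n) (Chen.LM n)) ∈ LCS.derDeg (Chen.FM n) k →
            Φ (LieSubmodule.Quotient.mk D) =
              (0, DirectSum.of (fun k : {k : ℕ // 2 ≤ k} => Sym[ℤ]^(k : ℕ) (Chen.H n)) ⟨k, hk⟩
                (TrM k (Chen.restr n D)))) := by
  have : Nontrivial (Fin n) := Fin.nontrivial_iff_two_le.2 (by omega)
  refine ⟨Chen.traceM n, fun k _ => Chen.traceM_comp_proj k, Chen.abEquiv n, fun D hD => ?_,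
    fun k hk D hD => ?_⟩
  · rw [Chen.abEquiv_mk, Chen.total_apply]
    exact ⟨Chen.lTensor_degOne hD, Chen.traces_of_degree_one hD⟩
  · rw [Chen.abEquiv_mk, Chen.total_apply, Chen.degOne_of_degree_ne (by omega) hD,
      Chen.traces_of_degree hk hD]
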